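/- Let $b \ge 2$ be an integer and let $\mathbf{x} = x_1 x_2 \ldots$ be an infinite word over $\{0, 1, \ldots, b-1\}$. For $n \ge 1$, let $$p(n, \mathbf{x}) = \mathrm{Card}\, \{ x_{j+1} x_{j+2} \dots x_{j+n} : j \ge 0 \}$$ be the number of different blocks of length $n$ occurring in $\mathbf{x}$, and let $$r(n, \mathbf{x}) = \min \{ m \ge 1 : x_{m+1} \dots x_{m+n} = x_{i+1} \dots x_{i+n} \text{ for some } 0 \le i < m \};$$ equivalently, $r(n, \mathbf{x})$ is the largest $m \ge 1$ such that the blocks $x_1 \dots x_n$, $x_2 \dots x_{n+1}$, $\ldots$, $x_m \dots x_{m+n-1}$ are all distinct. For an irrational real number $\xi$, let $\mu(\xi) \in [2, +\infty]$ denote its irrationality exponent, that is, the supremum of the real numbers $\mu$ for which the inequality $|\xi - p/q| < 1/q^{\mu}$ has infinitely many rational solutions $p/q$ with $q \ge 1$. Suppose that $\mathbf{x}$ is not ultimately periodic and satisfies $$\rho = \limsup_{n \to +\infty} \frac{p(n, \mathbf{x})}{n} < \frac{4}{3}.$$ Then we have $$\liminf_{n \to +\infty} \frac{r(n, \mathbf{x})}{n}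 \le 1 - \frac{4 - 3\rho}{2 (1 + 2\rho)(2 - \rho)}$$ and $$\mu \Bigl( \sum_{j \ge 1} \frac{x_j}{b^j} \Bigr) \ge 2 + \frac{4 - 3\rho}{\rho (9 - 4\rho)}.$$ -/

import Mathlib

/-- The word of length `n` occurring in the infinite word `x` right after its first `j` letters.
An infinite word `x₁ x₂ x₃ …` is a function on `ℕ`, its letter `x_{j+1}` being `x j`, so that
`factor x j n` is `x_{j+1} x_{j+2} … x_{j+n}`. -/
def factor {α : Type*} (x : ℕ → α) (j n : ℕ) : Fin n → α :=
  fun i => x (j + i)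

/-- The subword complexity `p(n, x)`: the number of different words of length `n` occurring
in `x`. -/
noncomputable def complexity {α : Type*} (n : ℕ) (x : ℕ → α) : ℕ :=
  (Set.range fun j => factor x j n).ncard

/-- The repetition function `r(n, x)`: the least `m ≥ 1` such that
`x_{m+1} … x_{m+n} = x_{i+1} … x_{i+n}` for some `0 ≤ i < m`. Over a finite alphabet such an `m`
exists; see `isLeast_repetition` and, for the description as a maximum,
`isGreatest_repetition`. -/
noncomputable def repetition {α : Type*} (n : ℕ) (x : ℕ → α) : ℕ :=
  sInf {m : ℕ | 1 ≤ m ∧ ∃ i < m, factor x m n = factor x i n}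

theorem isLeast_repetition {α : Type*} [Finite α] (n : ℕ) (x : ℕ → α) :
    IsLeast {m : ℕ | 1 ≤ m ∧ ∃ i < m, factor x m n = factor x i n} (repetition n x) := by
  have hne : {m : ℕ | 1 ≤ m ∧ ∃ i < m, factor x m n = factor x i n}.Nonempty := by
    obtain ⟨a, b, hab, h⟩ := Finite.exists_ne_map_eq_of_infinite fun j => factor x j n
    rcases lt_or_gt_of_ne hab with hl | hl
    · exact ⟨b, by omega, a, hl, h.symm⟩
    · exact ⟨a, by omega, b, hl, h⟩
  exact ⟨Nat.sInf_mem hne, fun m hm => Nat.sInf_le hm⟩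

/-- `r(n, x)` is also the greatest `m ≥ 1` such that `x₁ … x_n`, `x₂ … x_{n+1}`, …,
`x_m … x_{m+n-1}` are all distinct. -/
theorem isGreatest_repetition {α : Type*} [Finite α] (n : ℕ) (x : ℕ → α) :
    IsGreatest {m : ℕ | 1 ≤ m ∧ Set.InjOn (fun j => factor x j n) (Set.Iio m)}
      (repetition n x) := by
  obtain ⟨⟨h1, i, hi, he⟩, hmin⟩ := isLeast_repetition n x
  refine ⟨⟨h1, ?_⟩, ?_⟩
  · intro a ha b hb hab
    simp only [Set.mem_Iio] at ha hb
    by_contra hne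
    rcases lt_or_gt_of_ne hne with hl | hl
    · exact absurd (hmin ⟨by omega, a, hl, hab.symm⟩) (by omega)
    · exact absurd (hmin ⟨by omega, b, hl, hab⟩) (by omega)
  · rintro m ⟨_, hm⟩
    by_contra hlt
    have hlt' : repetition n x < m := by omega
    have := hm (Set.mem_Iio.2 hlt') (Set.mem_Iio.2 (hi.trans hlt')) he
    omega

/-- The infinite word `x` is ultimately periodic. -/
def UltimatelyPeriodic {α : Type*} (x : ℕ → α) : Prop :=
  ∃ N T : ℕ, 1 ≤ T ∧ ∀ n, N ≤ n → x (n + T) = x n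

/-- The irrationality exponent of `ξ`: the supremum, possibly `+∞`, of the real numbers `μ` such
that `|ξ - p/q| < 1/q^μ` has infinitely many rational solutions `p/q` with `q ≥ 1`. -/
noncomputable def irrationalityExponent (ξ : ℝ) : EReal :=
  sSup ((fun μ : ℝ => (μ : EReal)) ''
    {μ : ℝ | {s : ℚ | ∃ (p : ℤ) (q : ℕ), 1 ≤ q ∧ s = (p : ℚ) / (q : ℚ) ∧
      |ξ - (p : ℝ) / (q : ℝ)| < 1 / (q : ℝ) ^ μ}.Infinite})

/-! Suppose that `r(n, x) ≥ λ n` for all large `n`, with `λ = 8/25 + σ/2` and `σ` slightly above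
`ρ`; this `λ` does not exceed the claimed bound. As `p(n, x) < 4n/3` eventually, `p` grows by
exactly one at arbitrarily large `n`. Then only one word of length `n` is right special, it has two
continuations, and from its first occurrence on `x` is a concatenation of two return words, of
lengths `a` and `c`, in an order given by a binary sequence `d` (`exists_returnCoding`). Lengthening
the special word to the left until it is bispecial makes the last letters of the return words differ
(`exists_maximal`). Before its first occurrence stand `t` letters and then a suffix, of length `v`,
of a return word. Counting factors gives `t + a + c ≤ p(n) + 1` and `n < a + c` (`exists_withTail`,
`lt_len_add_len`).

The first few runs of `d` now force early repetitions: if the words of length `n + L` at `i < m`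
agree, then `λ (n + L) ≤ m`. Runs of different lengths also produce two right special words at once,
so that `p` grows by two over a range of lengths, while `p(m) ≤ σ m`. In each case the resulting
inequalities between `t`, `v`, `a`, `c` and the run lengths are inconsistent (`false_of_growth`).

For the exponent, a repetition of length `n` at `i < m = r(n)` yields a rational approximation with
denominator `b^m - b^i` (`exists_rat_approx`). This gives `μ ≥ 1 + 1/L` for every upper bound `L` of
the liminf, and the second claim follows from the first. -/

section Words

/-! ### Factors of an infinite word. -/

variable {α : Type*} {x : ℕ → α}

theorem factor_eq_iff {i j n : ℕ} :
    factor x i n = factor x j n ↔ ∀ m < n, x (i + m) = x (j + m) := by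
  constructor
  · intro h m hm
    exact congrFun h ⟨m, hm⟩
  · intro h
    funext m
    exact h m m.2

theorem factor_eq_of_le {i j m n : ℕ} (h : factor x i n = factor x j n) (hmn : m ≤ n) :
    factor x i m = factor x j m :=
  factor_eq_iff.2 fun k hk => factor_eq_iff.1 h k (hk.trans_le hmn)

theorem factor_add_eq {i j m n : ℕ} (h : factor x i (m + n) = factor x j (m + n)) :
    factor x (i + m) n = factor x (j + m) n :=
  factor_eq_iff.2 fun k hk => by
    simpa [add_assoc] using factor_eq_iff.1 h (m + k) (by omega)

theorem factor_append_eq {i j m n : ℕ} (h : factor x i m = factor x j m)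
    (h' : factor x (i + m) n = factor x (j + m) n) :
    factor x i (m + n) = factor x j (m + n) :=
  factor_eq_iff.2 fun k hk => by
    rcases lt_or_ge k m with hkm | hkm
    · exact factor_eq_iff.1 h k hkm
    · have := factor_eq_iff.1 h' (k - m) (by omega)
      rwa [show i + m + (k - m) = i + k by omega, show j + m + (k - m) = j + k by omega] at this

theorem factor_succ_eq_iff {i j n : ℕ} :
    factor x i (n + 1) = factor x j (n + 1) ↔
      factor x i n = factor x j n ∧ x (i + n) = x (j + n) := by
  simp only [factor_eq_iff]
  constructor
  · intro h
    exact ⟨fun m hm => h m (by omega), h n (by omega)⟩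
  · rintro ⟨h, h'⟩ m hm
    rcases Nat.lt_succ_iff_lt_or_eq.1 hm with hm | rfl
    · exact h m hm
    · exact h'

/-- If a word of length `n` determines its next letter at all positions outside `P`, then an
agreement of length `n` extends as long as `P` is avoided. -/
theorem factor_eq_extend {P : ℕ → Prop} {n : ℕ}
    (hP : ∀ i j, factor x i n = factor x j n → ¬ P i → x (i + n) = x (j + n)) {i j h : ℕ}
    (hij : factor x i n = factor x j n) (hi : ∀ k < h, ¬ P (i + k)) :
    factor x i (n + h) = factor x j (n + h) := by
  induction h with
  | zero => exact hij
  | succ h ih =>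
    have ih' := ih fun k hk => hi k (by omega)
    refine factor_succ_eq_iff.2 ⟨ih', ?_⟩
    have h1 : factor x (i + h) n = factor x (j + h) n :=
      factor_add_eq (by rwa [add_comm n h] at ih')
    have := hP _ _ h1 (hi h (by omega))
    rwa [show i + h + n = i + (n + h) by omega, show j + h + n = j + (n + h) by omega] at this

theorem repetition_le {i m n : ℕ} (hi : i < m) (h : factor x i n = factor x m n) :
    repetition n x ≤ m :=
  Nat.sInf_le ⟨by omega, i, hi, h.symm⟩

/-! ### Right special words and growth of the complexity. -/

section Finite

variable [Finite α]

/-- Otherwise the words of length `n` beyond `N` determine the next letter, and two equal ones,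
found by pigeonhole, continue alike forever. -/
theorem exists_factor_eq_ne (hx : ¬ UltimatelyPeriodic x) (N n : ℕ) :
    ∃ i j, N ≤ i ∧ N ≤ j ∧ factor x i n = factor x j n ∧ x (i + n) ≠ x (j + n) := by
  by_contra! hcon
  apply hx
  obtain ⟨a, b, hab, h⟩ : ∃ a b, a < b ∧ factor x (N + a) n = factor x (N + b) n := by
    obtain ⟨a, b, hab, h⟩ := Finite.exists_ne_map_eq_of_infinite fun j => factor x (N + j) n
    rcases lt_or_gt_of_ne hab with hl | hl
    · exact ⟨a, b, hl, h⟩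
    · exact ⟨b, a, hl, h.symm⟩
  have key : ∀ k, factor x (N + a) (n + k) = factor x (N + b) (n + k) := by
    intro k
    induction k with
    | zero => exact h
    | succ k ih =>
      refine factor_succ_eq_iff.2 ⟨ih, ?_⟩
      have h1 : factor x (N + a + k) n = factor x (N + b + k) n :=
        factor_add_eq (by rwa [add_comm n k] at ih)
      have := hcon _ _ (by omega) (by omega) h1
      rwa [show N + a + k + n = N + a + (n + k) by omega,
        show N + b + k + n = N + b + (n + k) by omega] at this
  refine ⟨N + a, b - a, by omega, fun m hm => ?_⟩
  have := factor_eq_iff.1 (key (m + 1)) (m - (N + a)) (by omega)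
  rw [show N + a + (m - (N + a)) = m by omega,
    show N + b + (m - (N + a)) = m + (b - a) by omega] at this
  exact this.symm

/-- Deleting the last letter still maps the factors of length `n + 1` outside `E` onto all factors
of length `n`. -/
theorem complexity_add_card_le {n : ℕ} (E : Finset (Fin (n + 1) → α))
    (hE : ∀ e ∈ E, ∃ i, factor x i (n + 1) = e)
    (h : ∀ i, ∃ j, factor x j n = factor x i n ∧ factor x j (n + 1) ∉ E) :
    complexity n x + E.card ≤ complexity (n + 1) x := by
  classical
  have hsub : (E : Set (Fin (n + 1) → α)) ⊆ Set.range fun j => factor x j (n + 1) := by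
    intro e he
    exact hE e he
  have h1 : ((Set.range fun j => factor x j (n + 1)) \ E).ncard + E.card =
      complexity (n + 1) x := by
    have := Set.ncard_sdiff_add_ncard_of_subset hsub (Set.toFinite _)
    rwa [Set.ncard_coe_finset] at this
  have h2 : complexity n x ≤ ((Set.range fun j => factor x j (n + 1)) \ E).ncard := by
    refine le_trans (Set.ncard_le_ncard ?_ (Set.toFinite _))
      (Set.ncard_image_le (f := fun w : Fin (n + 1) → α => fun k : Fin n => w k.castSucc)
        (Set.toFinite _))
    rintro _ ⟨i, rfl⟩
    obtain ⟨j, hj, hjE⟩ := h i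
    exact ⟨factor x j (n + 1), ⟨⟨j, rfl⟩, hjE⟩, hj⟩
  omega

/-- The extensions at `i'` and `j'` can both be removed. This covers two right special words as well
as one word with three continuations, where `i = j`. -/
theorem complexity_add_two_le {n i i' j j' : ℕ} (hi : factor x i n = factor x i' n)
    (hj : factor x j n = factor x j' n)
    (h₁ : factor x i' (n + 1) ≠ factor x j' (n + 1))
    (h₂ : factor x i (n + 1) ≠ factor x i' (n + 1))
    (h₃ : factor x i (n + 1) ≠ factor x j' (n + 1))
    (h₄ : factor x j (n + 1) ≠ factor x i' (n + 1))
    (h₅ : factor x j (n + 1) ≠ factor x j' (n + 1)) :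
    complexity n x + 2 ≤ complexity (n + 1) x := by
  classical
  rw [← Finset.card_pair h₁]
  refine complexity_add_card_le _ ?_ ?_
  · intro e he
    simp only [Finset.mem_insert, Finset.mem_singleton] at he
    rcases he with rfl | rfl <;> exact ⟨_, rfl⟩
  · intro k
    simp only [Finset.mem_insert, Finset.mem_singleton, not_or]
    by_cases hk : factor x k (n + 1) = factor x i' (n + 1)
    · exact ⟨i, hi.trans (factor_eq_of_le hk (by omega)).symm, h₂, h₃⟩
    by_cases hk' : factor x k (n + 1) = factor x j' (n + 1)
    · exact ⟨j, hj.trans (factor_eq_of_le hk' (by omega)).symm, h₄, h₅⟩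
    exact ⟨k, rfl, hk, hk'⟩

theorem complexity_lt_succ (hx : ¬ UltimatelyPeriodic x) (n : ℕ) :
    complexity n x + 1 ≤ complexity (n + 1) x := by
  obtain ⟨i, j, -, -, h, hne⟩ := exists_factor_eq_ne hx 0 n
  refine complexity_add_card_le {factor x j (n + 1)} ?_ ?_
  · simp
  · intro k
    simp only [Finset.mem_singleton]
    by_cases hk : factor x k (n + 1) = factor x j (n + 1)
    · exact ⟨i, h.trans (factor_eq_of_le hk (by omega)).symm,
        fun h' => hne (factor_succ_eq_iff.1 h').2⟩
    · exact ⟨k, rfl, hk⟩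

theorem complexity_add_le (hx : ¬ UltimatelyPeriodic x) (n h : ℕ) :
    complexity n x + h ≤ complexity (n + h) x := by
  induction h with
  | zero => simp
  | succ h ih =>
    have := complexity_lt_succ hx (n + h)
    rw [← add_assoc n h 1]
    omega

/-- The Morse-Hedlund bound. -/
theorem lt_complexity (hx : ¬ UltimatelyPeriodic x) (n : ℕ) : n + 1 ≤ complexity n x := by
  have h0 : 0 < complexity 0 x := by
    rw [complexity, Set.ncard_pos (Set.toFinite _)]
    exact Set.range_nonempty _
  have := complexity_add_le hx 0 n
  rw [zero_add] at this
  omega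

/-- Two right special words of each length from `n + g` on, up to length `n + H`. -/
theorem complexity_add_two_mul_le (hx : ¬ UltimatelyPeriodic x) {n H g e₁ e₁' e₂ e₂' : ℕ}
    (h₁ : H ≤ e₁) (h₁' : H ≤ e₁') (h₂ : H ≤ e₂) (h₂' : H ≤ e₂')
    (he₁ : factor x (e₁ - H) (n + H) = factor x (e₁' - H) (n + H))
    (he₂ : factor x (e₂ - H) (n + H) = factor x (e₂' - H) (n + H))
    (hn₁ : x (e₁ + n) ≠ x (e₁' + n)) (hn₂ : x (e₂ + n) ≠ x (e₂' + n))
    (hg : 0 < g) (hne : g ≤ H → x (e₁' - g) ≠ x (e₂' - g)) :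
    complexity n x + 2 * H ≤ complexity (n + H) x + g := by
  rcases lt_or_ge H g with hH | hH
  · have := complexity_add_le hx n H
    omega
  have hne := hne hH
  have step : ∀ h, g ≤ h → h < H →
      complexity (n + h) x + 2 ≤ complexity (n + h + 1) x := by
    intro h hgh hhH
    have aux : ∀ e e', H ≤ e → H ≤ e' →
        factor x (e - H) (n + H) = factor x (e' - H) (n + H) →
        factor x (e - h) (n + h) = factor x (e' - h) (n + h) := by
      intro e e' he he' hh
      have := factor_add_eq (i := e - H) (j := e' - H) (m := H - h) (n := n + h)
        (by rwa [show H - h + (n + h) = n + H by omega])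
      rwa [show e - H + (H - h) = e - h by omega,
        show e' - H + (H - h) = e' - h by omega] at this
    have hw : ∀ e f, H ≤ e → H ≤ f → x (e + n) ≠ x (f + n) →
        factor x (e - h) (n + h + 1) ≠ factor x (f - h) (n + h + 1) := by
      intro e f he hf hne heq
      apply hne
      have := (factor_succ_eq_iff.1 heq).2
      rwa [show e - h + (n + h) = e + n by omega, show f - h + (n + h) = f + n by omega] at this
    have a₁ := aux e₁ e₁' h₁ h₁' he₁
    have a₂ := aux e₂ e₂' h₂ h₂' he₂
    have hR : factor x (e₁' - h) (n + h) ≠ factor x (e₂' - h) (n + h) := by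
      intro heq
      apply hne
      have := factor_eq_iff.1 heq (h - g) (by omega)
      rwa [show e₁' - h + (h - g) = e₁' - g by omega,
        show e₂' - h + (h - g) = e₂' - g by omega] at this
    refine complexity_add_two_le a₁ a₂ ?_ (hw _ _ h₁ h₁' hn₁) ?_ ?_ (hw _ _ h₂ h₂' hn₂)
    · exact fun hh => hR (factor_succ_eq_iff.1 hh).1
    · exact fun hh => hR (a₁.symm.trans (factor_succ_eq_iff.1 hh).1)
    · exact fun hh => hR ((factor_succ_eq_iff.1 hh).1.symm.trans a₂)
  have main : ∀ k, g + k ≤ H →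
      complexity (n + g) x + 2 * k ≤ complexity (n + (g + k)) x := by
    intro k
    induction k with
    | zero => intro _; simp
    | succ k ih =>
      intro hk
      have h1 := ih (by omega)
      have h2 := step (g + k) (by omega) (by omega)
      rw [show n + (g + (k + 1)) = n + (g + k) + 1 by omega]
      omega
  have h1 := main (H - g) (by omega)
  rw [show g + (H - g) = H by omega] at h1
  -- Below length `n + g` the two special words may coincide, so only one new word per step is
  -- available.
  have h2 := complexity_add_le hx n g
  omega

end Finite

end Words

/-! ### Return words of a unique right special word. -/

section ReturnCoding

variable {α : Type*} {x : ℕ → α}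

/-- `q` lists the positions of the unique right special word of length `n` of `x`. The letter that
follows this word at `q i` is recorded by `d i`, and it determines the distance `len (d i)` to the
next occurrence. -/
structure ReturnCoding (x : ℕ → α) (n : ℕ) (len : Bool → ℕ) (q : ℕ → ℕ) (d : ℕ → Bool) :
    Prop where
  len_pos : ∀ s, 0 < len s
  q_succ : ∀ i, q (i + 1) = q i + len (d i)
  agree : ∀ i j, d i = d j → factor x (q i) (n + len (d i)) = factor x (q j) (n + len (d i))
  letter_ne : ∀ i j, d i ≠ d j → x (q i + n) ≠ x (q j + n)
  factor_eq : ∀ i j, factor x (q i) n = factor x (q j) n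
  exists_ge : ∀ N s, ∃ i, N ≤ i ∧ d i = s
  mem : ∀ p, factor x p n = factor x (q 0) n → ∃ i, p = q i
  special : ∀ p p', factor x p n = factor x p' n → x (p + n) ≠ x (p' + n) → ∃ i, p = q i

/-- Growth by one leaves room for a single right special word with just two continuations. Between
its occurrences every letter is forced, so the letter after one occurrence determines the path to
the next. -/
theorem exists_returnCoding [Finite α] (hx : ¬ UltimatelyPeriodic x) {n : ℕ}
    (hn : complexity (n + 1) x ≤ complexity n x + 1) :
    ∃ len q d, ReturnCoding x n len q d := by
  classical
  obtain ⟨i₀, j₀, -, -, h₀, hne₀⟩ := exists_factor_eq_ne hx 0 n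
  have special : ∀ p p', factor x p n = factor x p' n → x (p + n) ≠ x (p' + n) →
      factor x p n = factor x i₀ n := by
    intro p p' hp hne
    by_contra hcon
    have := complexity_add_two_le hp h₀ (fun h => ?_) (fun h => ?_) (fun h => ?_)
      (fun h => ?_) (fun h => ?_)
    · omega
    · exact hcon (hp.trans ((factor_succ_eq_iff.1 h).1.trans h₀.symm))
    · exact hne (factor_succ_eq_iff.1 h).2
    · exact hcon ((factor_succ_eq_iff.1 h).1.trans h₀.symm)
    · exact hcon (hp.trans (factor_succ_eq_iff.1 h).1.symm)
    · exact hne₀ (factor_succ_eq_iff.1 h).2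
  have two : ∀ p p', factor x p n = factor x i₀ n → factor x p' n = factor x i₀ n →
      x (p + n) ≠ x (i₀ + n) → x (p' + n) ≠ x (i₀ + n) → x (p + n) = x (p' + n) := by
    intro p p' hp hp' h h'
    by_contra hcon
    have := complexity_add_two_le hp.symm hp'.symm (fun e => ?_) (fun e => ?_) (fun e => ?_)
      (fun e => ?_) (fun e => ?_)
    · omega
    · exact hcon (factor_succ_eq_iff.1 e).2
    · exact h (factor_succ_eq_iff.1 e).2.symm
    · exact h' (factor_succ_eq_iff.1 e).2.symm
    · exact h (factor_succ_eq_iff.1 e).2.symm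
    · exact h' (factor_succ_eq_iff.1 e).2.symm
  set P : ℕ → Prop := fun p => factor x p n = factor x i₀ n with hPdef
  have both : ∀ N, ∃ i j, N ≤ i ∧ N ≤ j ∧ P i ∧ P j ∧ x (i + n) = x (i₀ + n) ∧
      x (j + n) ≠ x (i₀ + n) := by
    intro N
    obtain ⟨i, j, hi, hj, h, hne⟩ := exists_factor_eq_ne hx N n
    have hPi := special i j h hne
    have hPj := special j i h.symm hne.symm
    by_cases h1 : x (i + n) = x (i₀ + n)
    · exact ⟨i, j, hi, hj, hPi, hPj, h1, fun h2 => hne (h1.trans h2.symm)⟩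
    · by_cases h2 : x (j + n) = x (i₀ + n)
      · exact ⟨j, i, hj, hi, hPj, hPi, h2, h1⟩
      · exact absurd (two i j hPi hPj h1 h2) hne
  have hinf : {p | P p}.Infinite := by
    rw [Set.infinite_iff_exists_gt]
    intro N
    obtain ⟨i, j, hi, -, hPi, -⟩ := both (N + 1)
    exact ⟨i, hPi, by omega⟩
  set q : ℕ → ℕ := Nat.nth P with hq
  have hqP : ∀ k, P (q k) := fun k => Nat.nth_mem_of_infinite hinf k
  have hqmono : StrictMono q := Nat.nth_strictMono hinf
  have hqsurj : ∀ p, P p → ∃ k, p = q k := by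
    intro p hp
    have : p ∈ Set.range (Nat.nth P) := by
      rw [Nat.range_nth_of_infinite hinf]; exact hp
    obtain ⟨k, hk⟩ := this
    exact ⟨k, hk.symm⟩
  set d : ℕ → Bool := fun k => decide (x (q k + n) = x (i₀ + n)) with hd
  have hdT : ∀ k, d k = true ↔ x (q k + n) = x (i₀ + n) := fun k => by simp [hd]
  have letter : ∀ i j, d i = d j ↔ x (q i + n) = x (q j + n) := by
    intro i j
    rw [Bool.eq_iff_iff, hdT, hdT]
    constructor
    · intro h
      by_cases h1 : x (q i + n) = x (i₀ + n)
      · exact h1.trans (h.1 h1).symm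
      · exact two _ _ (hqP i) (hqP j) h1 (fun h2 => h1 (h.2 h2))
    · intro h
      rw [h]
  have feq : ∀ i j, factor x (q i) n = factor x (q j) n := fun i j =>
    (hqP i).trans (hqP j).symm
  have hnot : ∀ k p, q k < p → p < q (k + 1) → ¬ P p := by
    intro k p h1 h2 hp
    obtain ⟨l, rfl⟩ := hqsurj p hp
    have := hqmono.lt_iff_lt.1 h1
    have := hqmono.lt_iff_lt.1 h2
    omega
  have ext : ∀ i j, factor x i n = factor x j n → ¬ P i → x (i + n) = x (j + n) := by
    intro i j hij hi
    by_contra h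
    exact hi (special i j hij h)
  have gap_agree : ∀ k l, d k = d l →
      factor x (q k) (n + (q (k + 1) - q k)) = factor x (q l) (n + (q (k + 1) - q k)) := by
    intro k l hkl
    have h1 : factor x (q k) (1 + n) = factor x (q l) (1 + n) := by
      rw [add_comm]
      exact factor_succ_eq_iff.2 ⟨feq k l, (letter k l).1 hkl⟩
    have hlt := hqmono (Nat.lt_add_one k)
    have h2 := factor_eq_extend (P := P) ext (h := q (k + 1) - q k - 1) (factor_add_eq h1)
      (fun m hm => hnot k _ (by omega) (by omega))
    have h3 := factor_append_eq (factor_eq_of_le h1 (by omega)) h2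
    rwa [show 1 + (n + (q (k + 1) - q k - 1)) = n + (q (k + 1) - q k) by omega] at h3
  have gap_le : ∀ k l, d k = d l → q (l + 1) - q l ≤ q (k + 1) - q k := by
    intro k l hkl
    have h1 := gap_agree k l hkl
    rw [add_comm] at h1
    have h2 := factor_add_eq h1
    have hlt := hqmono (Nat.lt_add_one k)
    have hlt' := hqmono (Nat.lt_add_one l)
    rw [show q k + (q (k + 1) - q k) = q (k + 1) by omega] at h2
    by_contra hcon
    exact hnot l (q l + (q (k + 1) - q k)) (by omega) (by omega) (h2.symm.trans (hqP (k + 1)))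
  have exists_ge : ∀ N s, ∃ i, N ≤ i ∧ d i = s := by
    intro N s
    obtain ⟨i, j, hi, hj, hPi, hPj, h1, h2⟩ := both (q N)
    obtain ⟨k, rfl⟩ := hqsurj i hPi
    obtain ⟨l, rfl⟩ := hqsurj j hPj
    cases s with
    | true => exact ⟨k, hqmono.le_iff_le.1 hi, (hdT k).2 h1⟩
    | false =>
      refine ⟨l, hqmono.le_iff_le.1 hj, ?_⟩
      rw [← Bool.not_eq_true, hdT]
      exact h2
  choose r hr hdr using fun s => exists_ge 0 s
  set len : Bool → ℕ := fun s => q (r s + 1) - q (r s) with hlen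
  have hgap : ∀ k, len (d k) = q (k + 1) - q k := fun k =>
    le_antisymm (gap_le k (r (d k)) (hdr _).symm) (gap_le (r (d k)) k (hdr _))
  refine ⟨len, q, d, ⟨?_, ?_, ?_, ?_, feq, exists_ge, ?_, ?_⟩⟩
  · intro s
    have := hqmono (Nat.lt_add_one (r s))
    simp only [hlen]
    omega
  · intro i
    have := hqmono (Nat.lt_add_one i)
    rw [hgap]
    omega
  · intro i j hij
    rw [hgap]
    exact gap_agree i j hij
  · intro i j hij h
    exact hij ((letter i j).2 h)
  · intro p hp
    exact hqsurj p (hp.trans (hqP 0))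
  · intro p p' h hne
    exact hqsurj p (special p p' h hne)

namespace ReturnCoding

variable {n : ℕ} {len : Bool → ℕ} {q : ℕ → ℕ} {d : ℕ → Bool}

theorem q_strictMono (C : ReturnCoding x n len q d) : StrictMono q :=
  strictMono_nat_of_lt_succ fun i => by
    have := C.q_succ i
    have := C.len_pos (d i)
    omega

theorem not_mem_between (C : ReturnCoding x n len q d) {k p : ℕ} (h₁ : q k < p)
    (h₂ : p < q (k + 1)) : ¬ ∃ i, p = q i := by
  rintro ⟨l, rfl⟩
  have := C.q_strictMono.lt_iff_lt.1 h₁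
  have := C.q_strictMono.lt_iff_lt.1 h₂
  omega

theorem mem_of_factor_eq (C : ReturnCoding x n len q d) {p k : ℕ}
    (h : factor x p n = factor x (q k) n) : ∃ i, p = q i :=
  C.mem p (h.trans (C.factor_eq k 0))

/-- If the last letters of all return words coincide, the right special word extends to the
left. -/
theorem extend_left (C : ReturnCoding x n len q d)
    (h : ¬ ∀ i j, d i ≠ d j → x (q (i + 1) - 1) ≠ x (q (j + 1) - 1)) :
    ∃ q' d', ReturnCoding x (n + 1) len q' d' := by
  push Not at h
  obtain ⟨i₀, j₀, hd₀, hx₀⟩ := h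
  have last : ∀ i j, d i = d j → x (q (i + 1) - 1) = x (q (j + 1) - 1) := by
    intro i j hij
    have := factor_eq_iff.1 (C.agree i j hij) (len (d i) - 1)
      (by have := C.len_pos (d i); omega)
    have h1 := C.q_succ i
    have h2 := C.q_succ j
    rw [← hij] at h2
    have h3 := C.len_pos (d i)
    rwa [show q i + (len (d i) - 1) = q (i + 1) - 1 by omega,
      show q j + (len (d i) - 1) = q (j + 1) - 1 by omega] at this
  set γ := x (q (i₀ + 1) - 1) with hγ
  have hlast : ∀ k, x (q (k + 1) - 1) = γ := by
    intro k
    by_cases hk : d k = d i₀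
    · exact last k i₀ hk
    · have : d k = d j₀ := by
        revert hk hd₀
        cases d k <;> cases d i₀ <;> cases d j₀ <;> simp
      exact (last k j₀ this).trans hx₀.symm
  have hpos : ∀ k, 0 < q (k + 1) := fun k => by
    have := C.q_succ k
    have := C.len_pos (d k)
    omega
  -- the positions of the extended word are the `q k - 1` with `k ≥ K`
  obtain ⟨K, hK, hKpos, hKmin⟩ : ∃ K, (∀ k, K ≤ k → x (q k - 1) = γ) ∧ (∀ k, K ≤ k → 0 < q k) ∧
      ∀ k, 0 < q k → x (q k - 1) = γ → K ≤ k := by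
    -- `K = 1` discards a first occurrence at position `0` or preceded by another letter.
    by_cases h0 : 0 < q 0 ∧ x (q 0 - 1) = γ
    · refine ⟨0, fun k _ => ?_, fun k _ => ?_, fun k _ _ => Nat.zero_le k⟩
      · cases k with
        | zero => exact h0.2
        | succ k => exact hlast k
      · cases k with
        | zero => exact h0.1
        | succ k => exact hpos k
    · refine ⟨1, fun k hk => ?_, fun k hk => ?_, fun k hk hk' => ?_⟩
      · obtain ⟨k, rfl⟩ := Nat.exists_eq_add_of_le' hk
        exact hlast k
      · obtain ⟨k, rfl⟩ := Nat.exists_eq_add_of_le' hk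
        exact hpos k
      · cases k with
        | zero => exact absurd ⟨hk, hk'⟩ h0
        | succ k => omega
  have cons_eq : ∀ i j m, 0 < i → 0 < j → x (i - 1) = x (j - 1) →
      factor x i m = factor x j m → factor x (i - 1) (1 + m) = factor x (j - 1) (1 + m) := by
    intro i j m hi hj h1 h2
    refine factor_append_eq (factor_eq_iff.2 fun k hk => ?_) ?_
    · obtain rfl : k = 0 := by omega
      exact h1
    · rwa [Nat.sub_add_cancel hi, Nat.sub_add_cancel hj]
  refine ⟨fun i => q (K + i) - 1, fun i => d (K + i), ⟨C.len_pos, ?_, ?_, ?_, ?_, ?_, ?_, ?_⟩⟩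
  · intro i
    have h1 := C.q_succ (K + i)
    have h2 := hKpos (K + i) (by omega)
    simp only [← add_assoc]
    omega
  · intro i j hij
    have := cons_eq (q (K + i)) (q (K + j)) _ (hKpos _ (by omega)) (hKpos _ (by omega))
      ((hK _ (by omega)).trans (hK _ (by omega)).symm) (C.agree _ _ hij)
    rwa [show 1 + (n + len (d (K + i))) = n + 1 + len (d (K + i)) by omega] at this
  · intro i j hij
    have h1 := hKpos (K + i) (by omega)
    have h2 := hKpos (K + j) (by omega)
    have := C.letter_ne _ _ hij
    rwa [show q (K + i) - 1 + (n + 1) = q (K + i) + n by omega,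
      show q (K + j) - 1 + (n + 1) = q (K + j) + n by omega]
  · intro i j
    have := cons_eq (q (K + i)) (q (K + j)) _ (hKpos _ (by omega)) (hKpos _ (by omega))
      ((hK _ (by omega)).trans (hK _ (by omega)).symm) (C.factor_eq _ _)
    rwa [add_comm 1 n] at this
  · intro N s
    obtain ⟨i, hi, hs⟩ := C.exists_ge (N + K) s
    refine ⟨i - K, by omega, ?_⟩
    rwa [show K + (i - K) = i by omega]
  · intro p hp
    have h0 := hKpos K le_rfl
    rw [add_comm n 1] at hp
    have h1 := factor_add_eq hp
    simp only [add_zero] at h1 hp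
    rw [show q K - 1 + 1 = q K by omega] at h1
    obtain ⟨k, hk⟩ := C.mem_of_factor_eq h1
    have h2 := factor_eq_iff.1 hp 0 (by omega)
    simp only [add_zero] at h2
    have := hKmin k (by omega) (by rw [← hk, Nat.add_sub_cancel, h2, hK K le_rfl])
    refine ⟨k - K, ?_⟩
    rw [show K + (k - K) = k by omega]
    omega
  · intro p p' hp hne
    rw [add_comm n 1] at hp
    have h1 := factor_add_eq hp
    rw [show p + (n + 1) = p + 1 + n by omega, show p' + (n + 1) = p' + 1 + n by omega] at hne
    obtain ⟨k, hk⟩ := C.special _ _ h1 hne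
    obtain ⟨l, hl⟩ := C.special _ _ h1.symm hne.symm
    have h2 := factor_eq_iff.1 hp 0 (by omega)
    simp only [add_zero] at h2
    have hkl : k ≠ l := by
      rintro rfl
      apply hne
      rw [hk, hl]
    -- As `k ≠ l`, one of the two occurrences is not the first and is preceded by `γ`; `h2`
    -- transfers this to the other.
    have hpk : x p = γ := by
      rcases Nat.eq_zero_or_pos k with rfl | hk0
      · obtain ⟨l, rfl⟩ := Nat.exists_eq_succ_of_ne_zero hkl.symm
        have := hlast l
        rw [show l.succ = l + 1 from rfl] at hl
        rwa [← hl, Nat.add_sub_cancel, ← h2] at this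
      · obtain ⟨k, rfl⟩ := Nat.exists_eq_succ_of_ne_zero hk0.ne'
        have := hlast k
        rw [show k.succ = k + 1 from rfl] at hk
        rwa [← hk, Nat.add_sub_cancel] at this
    have := hKmin k (by omega) (by rw [← hk, Nat.add_sub_cancel, hpk])
    refine ⟨k - K, ?_⟩
    rw [show K + (k - K) = k by omega]
    omega

end ReturnCoding

end ReturnCoding

/-! ### Bispecial words and the part before the first return position. -/

namespace ReturnCoding

variable {α : Type*} {x : ℕ → α} {n : ℕ} {len : Bool → ℕ} {q : ℕ → ℕ} {d : ℕ → Bool}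

theorem exists_block (C : ReturnCoding x n len q d) {p : ℕ} (hp : q 0 ≤ p) :
    ∃ k, q k ≤ p ∧ p < q (k + 1) := by
  classical
  have h : ∃ k, p < q k := ⟨p + 1, lt_of_lt_of_le (Nat.lt_add_one p) C.q_strictMono.le_apply⟩
  have h1 := Nat.find_spec h
  have h0 : Nat.find h ≠ 0 := fun h0 => by
    rw [h0] at h1
    omega
  obtain ⟨k, hk⟩ := Nat.exists_eq_succ_of_ne_zero h0
  refine ⟨k, not_lt.1 (Nat.find_min h (by omega)), ?_⟩
  rwa [hk] at h1

/-- From `q 0` on, a factor of length `n` is fixed by a return word and an offset in it. The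
Morse-Hedlund bound for the shifted word does the rest. -/
theorem lt_len_add_len [Finite α] (hx : ¬ UltimatelyPeriodic x)
    (C : ReturnCoding x n len q d) : n + 1 ≤ len true + len false := by
  classical
  have hy : ¬ UltimatelyPeriodic fun k => x (q 0 + k) := by
    rintro ⟨N, T, hT, h⟩
    refine hx ⟨q 0 + N, T, hT, fun m hm => ?_⟩
    have : x (q 0 + (m - q 0 + T)) = x (q 0 + (m - q 0)) := h (m - q 0) (by omega)
    rwa [show q 0 + (m - q 0 + T) = m + T by omega,
      show q 0 + (m - q 0) = m by omega] at this
  refine (lt_complexity hy n).trans ?_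
  choose r _ hr using fun s => C.exists_ge 0 s
  let E : Finset (Fin n → α) :=
    (Finset.Ico (q (r true)) (q (r true) + len true)).image (fun p => factor x p n) ∪
      (Finset.Ico (q (r false)) (q (r false) + len false)).image (fun p => factor x p n)
  have hsub : (Set.range fun j => factor (fun k => x (q 0 + k)) j n) ⊆ (E : Set (Fin n → α)) := by
    rintro _ ⟨j, rfl⟩
    obtain ⟨k, hk, hk'⟩ := C.exists_block (p := q 0 + j) (by omega)
    have hs := C.q_succ k
    have h1 : factor (fun k => x (q 0 + k)) j n = factor x (q 0 + j) n := by
      funext m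
      simp [factor, add_assoc]
    have h2 : factor x (q 0 + j) n = factor x (q (r (d k)) + (q 0 + j - q k)) n := by
      have h3 := factor_eq_of_le (C.agree k (r (d k)) (hr _).symm)
        (m := q 0 + j - q k + n) (by omega)
      have h4 := factor_add_eq h3
      rwa [show q k + (q 0 + j - q k) = q 0 + j by omega] at h4
    simp only [h1, h2, E, Finset.coe_union, Finset.coe_image, Set.mem_union, Set.mem_image,
      Finset.coe_Ico, Set.mem_Ico]
    cases hd : d k with
    | true =>
      rw [hd] at hs
      exact Or.inl ⟨_, by omega, rfl⟩
    | false =>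
      rw [hd] at hs
      exact Or.inr ⟨_, by omega, rfl⟩
  have h1 := Set.ncard_le_ncard hsub (Finset.finite_toSet E)
  rw [Set.ncard_coe_finset] at h1
  refine h1.trans ((Finset.card_union_le _ _).trans (Nat.add_le_add ?_ ?_)) <;>
    exact Finset.card_image_le.trans (by simp)

/-- Extending to the left preserves `len`, and `lt_len_add_len` bounds `n` in terms of `len`, so the
extension must stop. -/
theorem exists_maximal [Finite α] (hx : ¬ UltimatelyPeriodic x)
    (C : ReturnCoding x n len q d) :
    ∃ m q' d', n ≤ m ∧ ReturnCoding x m len q' d' ∧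
      ∀ i j, d' i ≠ d' j → x (q' (i + 1) - 1) ≠ x (q' (j + 1) - 1) := by
  classical
  by_contra! hcon
  have : ∀ k, ∃ q' d', ReturnCoding x (n + k) len q' d' := by
    intro k
    induction k with
    | zero => exact ⟨q, d, C⟩
    | succ k ih =>
      obtain ⟨q', d', C'⟩ := ih
      refine C'.extend_left fun h => ?_
      obtain ⟨i, j, hij, he⟩ := hcon _ q' d' (Nat.le_add_right n k) C'
      exact h i j hij he
  obtain ⟨q', d', C'⟩ := this (len true + len false)
  have := C'.lt_len_add_len hx
  omega

theorem factor_eq_of_not_mem (C : ReturnCoding x n len q d) {p p' h : ℕ}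
    (hp : factor x p n = factor x p' n) (hno : ∀ k < h, ¬ ∃ i, p + k = q i) :
    factor x p (n + h) = factor x p' (n + h) :=
  factor_eq_extend (P := fun p => ∃ i, p = q i)
    (fun i j hij hi => by
      by_contra hne
      exact hi (C.special i j hij hne)) hp hno

/-- Positions with the same word are at the same distance from the next return position. -/
theorem eq_of_factor_eq (C : ReturnCoding x n len q d) {p p' h h' i i' : ℕ}
    (hp : factor x p n = factor x p' n) (hi : p + h = q i) (hi' : p' + h' = q i')
    (hno : ∀ k < h, ¬ ∃ i, p + k = q i) (hno' : ∀ k < h', ¬ ∃ i, p' + k = q i) : h = h' := by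
  have aux : ∀ {p p' h h' i : ℕ}, factor x p n = factor x p' n → p + h = q i →
      (∀ k < h, ¬ ∃ i, p + k = q i) → (∀ k < h', ¬ ∃ i, p' + k = q i) → h' ≤ h := by
    intro p p' h h' i hp hi hno hno'
    have h1 := C.factor_eq_of_not_mem hp hno
    rw [add_comm] at h1
    have h2 := factor_add_eq h1
    rw [hi] at h2
    by_contra hlt
    exact hno' h (by omega) (C.mem_of_factor_eq h2.symm)
  exact le_antisymm (aux hp.symm hi' hno' hno) (aux hp hi hno hno')

/-- The word `x` starts with `t` letters, followed by a suffix of length `v` of the return word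
of type `s`, up to the first return position. -/
structure WithTail (x : ℕ → α) (n : ℕ) (len : Bool → ℕ) (q : ℕ → ℕ) (d : ℕ → Bool)
    (t v : ℕ) (s : Bool) : Prop extends ReturnCoding x n len q d where
  last_ne : ∀ i j, d i ≠ d j → x (q (i + 1) - 1) ≠ x (q (j + 1) - 1)
  q_zero : q 0 = t + v
  le_len : v ≤ len s
  tail : ∀ i, d i = s → factor x t (v + n) = factor x (q (i + 1) - v) (v + n)
  card_le : t + len true + len false ≤ complexity n x + 1
  lt_len : n + 1 ≤ len true + len false

/-- Here `t` is the least position from which the letters up to `q 0` form a suffix of a return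
word. By minimality the words at the `t` earlier positions do not occur along the return words: the
Rauzy graph consists of an initial path and two loops. -/
theorem exists_withTail [Finite α] (hx : ¬ UltimatelyPeriodic x)
    (C : ReturnCoding x n len q d)
    (hl : ∀ i j, d i ≠ d j → x (q (i + 1) - 1) ≠ x (q (j + 1) - 1)) :
    ∃ t v s, WithTail x n len q d t v s := by
  classical
  let M : ℕ → Prop := fun p => p ≤ q 0 ∧ ∃ i, q 0 - p ≤ len (d i) ∧
    factor x p (q 0 - p) = factor x (q (i + 1) - (q 0 - p)) (q 0 - p)
  have hM : ∃ p, M p := ⟨q 0, le_rfl, 0, by simp, factor_eq_iff.2 fun m hm => by omega⟩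
  set t := Nat.find hM with ht
  obtain ⟨htq, i₀, hv, hfac⟩ := Nat.find_spec hM
  rw [← ht] at htq hv hfac
  have hmin : ∀ p < t, ¬ M p := fun p hp => Nat.find_min hM hp
  refine ⟨t, q 0 - t, d i₀, ⟨C, hl, by omega, hv, ?_, ?_, C.lt_len_add_len hx⟩⟩
  · intro i hi
    have h1 := C.q_succ i₀
    have h2 := C.q_succ i
    rw [hi] at h2
    have h3 := C.agree i₀ i hi.symm
    rw [show n + len (d i₀) = (len (d i₀) - (q 0 - t)) + (q 0 - t + n) by omega] at h3
    have h4 := factor_add_eq h3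
    rw [show q i₀ + (len (d i₀) - (q 0 - t)) = q (i₀ + 1) - (q 0 - t) by omega,
      show q i + (len (d i₀) - (q 0 - t)) = q (i + 1) - (q 0 - t) by omega] at h4
    refine Eq.trans (factor_append_eq hfac ?_) h4
    rw [show t + (q 0 - t) = q 0 by omega,
      show q (i₀ + 1) - (q 0 - t) + (q 0 - t) = q (i₀ + 1) by omega]
    exact C.factor_eq _ _
  · choose r _ hr using fun s => C.exists_ge 0 s
    have hrs : ∀ s, q (r s + 1) = q (r s) + len s := fun s => by
      rw [C.q_succ, hr]
    -- the position at distance `h` before the end of a return word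
    have hno : ∀ s h, h < len s → ∀ k < h, ¬ ∃ i, q (r s + 1) - h + k = q i := by
      intro s h hh k hk
      have := hrs s
      exact C.not_mem_between (k := r s) (by omega) (by omega)
    have hno0 : ∀ p, p < t → ∀ k < q 0 - p, ¬ ∃ i, p + k = q i := by
      rintro p hp k hk ⟨i, hi⟩
      have := C.q_strictMono.monotone (Nat.zero_le i)
      omega
    have tail_ne : ∀ p s h, p < t → h < len s →
        factor x p n ≠ factor x (q (r s + 1) - h) n := by
      intro p s h hp hh heq
      have hs := hrs s
      have hd := C.eq_of_factor_eq heq (h := q 0 - p) (h' := h) (i := 0) (i' := r s + 1)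
        (by omega) (by omega) (hno0 p hp) (hno s h hh)
      refine hmin p hp ⟨by omega, r s, by rw [hr]; omega, ?_⟩
      have := C.factor_eq_of_not_mem heq (hno0 p hp)
      rw [← hd] at this
      exact factor_eq_of_le this (by omega)
    have tail_inj : ∀ p p', p < t → p' < t → factor x p n = factor x p' n → p = p' := by
      intro p p' hp hp' heq
      have := C.eq_of_factor_eq heq (h := q 0 - p) (h' := q 0 - p') (i := 0) (i' := 0)
        (by omega) (by omega) (hno0 p hp) (hno0 p' hp')
      omega
    have loop_inj : ∀ s s' h h', h < len s → h' < len s' →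
        factor x (q (r s + 1) - h) n = factor x (q (r s' + 1) - h') n →
        h = h' ∧ (0 < h → s = s') := by
      intro s s' h h' hh hh' heq
      have hs := hrs s
      have hs' := hrs s'
      have hd := C.eq_of_factor_eq heq (h := h) (h' := h') (i := r s + 1) (i' := r s' + 1)
        (by omega) (by omega) (hno s h hh) (hno s' h' hh')
      refine ⟨hd, fun hpos => ?_⟩
      -- Equal words at distance `h > 0` before a return continue alike up to the last letter, which
      -- tells the return words apart.
      by_contra hss
      apply hl (r s) (r s') (by rwa [hr, hr])
      have := factor_eq_iff.1 (C.factor_eq_of_not_mem heq (hno s h hh)) (h - 1) (by omega)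
      rwa [show q (r s + 1) - h + (h - 1) = q (r s + 1) - 1 by omega,
        show q (r s' + 1) - h' + (h - 1) = q (r s' + 1) - 1 by omega] at this
    -- The loops share the special word, so distance `0` is omitted from the second one; hence the
    -- `+ 1` in `card_le`.
    let f : Fin t ⊕ Fin (len true) ⊕ Fin (len false - 1) → (Fin n → α) :=
      Sum.elim (fun p => factor x p n) (Sum.elim (fun h => factor x (q (r true + 1) - h) n)
        (fun h => factor x (q (r false + 1) - (h + 1)) n))
    have hf : Function.Injective f := by
      have hb : ∀ h : Fin (len false - 1), (h : ℕ) + 1 < len false := fun h => by omega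
      rintro (p | h | h) (p' | h' | h') heq <;> simp only [f, Sum.elim_inl, Sum.elim_inr] at heq
      · rw [Fin.ext (tail_inj _ _ p.2 p'.2 heq)]
      · exact absurd heq (tail_ne _ _ _ p.2 h'.2)
      · exact absurd heq (tail_ne _ _ _ p.2 (hb h'))
      · exact absurd heq.symm (tail_ne _ _ _ p'.2 h.2)
      · rw [Fin.ext (loop_inj _ _ _ _ h.2 h'.2 heq).1]
      · have := loop_inj _ _ _ _ h.2 (hb h') heq
        exact absurd (this.2 (by omega)) (by simp)
      · exact absurd heq.symm (tail_ne _ _ _ p'.2 (hb h))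
      · have := loop_inj _ _ _ _ (hb h) h'.2 heq
        exact absurd (this.2 (by omega)) (by simp)
      · have := (loop_inj _ _ _ _ (hb h) (hb h') heq).1
        rw [show h = h' from Fin.ext (by omega)]
    have hcard : (Set.range f).ncard = t + (len true + (len false - 1)) := by
      rw [← Set.image_univ, Set.ncard_image_of_injective _ hf, Set.ncard_univ]
      simp
    have hsub : Set.range f ⊆ Set.range fun j => factor x j n := by
      rintro _ ⟨p | h | h, rfl⟩ <;> exact ⟨_, rfl⟩
    have h1 := Set.ncard_le_ncard hsub (Set.toFinite _)
    have h2 := C.len_pos false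
    rw [complexity]
    omega

end ReturnCoding

/-- There are arbitrarily long right special words with a coding, when the complexity is small. -/
theorem exists_withTail_of_complexity_lt {α : Type*} [Finite α] {x : ℕ → α}
    (hx : ¬ UltimatelyPeriodic x) (N : ℕ)
    (hN : ∃ᶠ n in Filter.atTop, complexity n x + 2 * N < 2 * n) :
    ∃ n len q d t v s, N ≤ n ∧ ReturnCoding.WithTail x n len q d t v s := by
  -- Otherwise the complexity would grow by at least two at every step from `N` on.
  obtain ⟨m, hm, hm'⟩ : ∃ m, N ≤ m ∧ complexity (m + 1) x ≤ complexity m x + 1 := by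
    by_contra! hcon
    have h1 : ∀ k, 2 * k ≤ complexity (N + k) x := by
      intro k
      induction k with
      | zero => simp
      | succ k ih =>
        have := hcon (N + k) (by omega)
        rw [← add_assoc]
        omega
    obtain ⟨n, hn, hlt⟩ := (Filter.frequently_atTop.1 hN) N
    have := h1 (n - N)
    rw [show N + (n - N) = n by omega] at this
    omega
  obtain ⟨len, q, d, C⟩ := exists_returnCoding hx hm'
  obtain ⟨n, q', d', hn, C', hl⟩ := C.exists_maximal hx
  obtain ⟨t, v, s, T⟩ := C'.exists_withTail hx hl
  exact ⟨n, len, q', d', t, v, s, hm.trans hn, T⟩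

section Bounds

/-! Linear systems for the lengths `t`, `v`, `a`, `c` of the tail and of the two return words
that have no solution when `s ≤ 4 / 3`. Here `y` and `z` are lengths of runs. -/

/-- For `linarith` the products of `s` with the lengths are new unknowns; the products of the
lengths with `s - 1` and `4 / 3 - s` bound them. Where these bounds are too weak, the range of `s`
is subdivided. -/
theorem infeasible_true_true {s n t v a c : ℝ} (hn : 0 < n) (hv : 0 ≤ v) (ha : 0 ≤ a)
    (hc : 0 ≤ c) (hs : 1 ≤ s) (hs' : s ≤ 4 / 3) (hp : t + a + c ≤ s * n) (hac : n ≤ a + c)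
    (h₁ : (8 / 25 + s / 2) * (n + v + a) ≤ t + a) : False := by
  linarith [hc, mul_nonneg (sub_nonneg.2 hs') hn.le, mul_nonneg (sub_nonneg.2 hs) hv,
    mul_nonneg (sub_nonneg.2 hs) ha]

theorem infeasible_true_run_le {s n t v a c y : ℝ} (hn : 0 < n) (hv : 0 ≤ v) (ha : 0 ≤ a)
    (hc : 0 ≤ c) (hy : 0 ≤ y) (hs : 1 ≤ s) (hs' : s ≤ 4 / 3) (hp : t + a + c ≤ s * n)
    (hac : n ≤ a + c) (h₁ : (8 / 25 + s / 2) * (n + v) ≤ t + a)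
    (h₂ : (8 / 25 + s / 2) * (n + y - c) ≤ t + v + a + c)
    (h₃ : (8 / 25 + s / 2) * (n + a + y) ≤ t + v + a + y) : False := by
  rcases le_total s (7 / 6) with e | e
  · linarith [mul_nonneg (sub_nonneg.2 e) hn.le, mul_nonneg (sub_nonneg.2 hs) hv,
      mul_nonneg (sub_nonneg.2 hs) ha, mul_nonneg (sub_nonneg.2 e) hc,
      mul_nonneg (sub_nonneg.2 hs) hy]
  linarith [mul_nonneg (sub_nonneg.2 hs') hn.le, mul_nonneg (sub_nonneg.2 e) hv,
    mul_nonneg (sub_nonneg.2 e) ha, mul_nonneg (sub_nonneg.2 hs') hc,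
    mul_nonneg (sub_nonneg.2 e) hy]

theorem infeasible_true_run_lt_of_le {s n t v a c y z : ℝ} (hn : 0 < n) (hv : 0 ≤ v)
    (ha : 0 ≤ a) (hc : 0 ≤ c) (hy : 0 ≤ y) (hz : 0 ≤ z) (hs : 1 ≤ s) (hs' : s ≤ 4 / 3)
    (hp : t + a + c ≤ s * n) (hac : n ≤ a + c) (h₁ : (8 / 25 + s / 2) * (n + v) ≤ t + a)
    (h₂ : (8 / 25 + s / 2) * (n + y - c) ≤ t + v + a + c)
    (h₃ : (8 / 25 + s / 2) * (n + a + z) ≤ t + v + a + y)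
    (h₄ : t + a + c + 2 * (y - c) - z ≤ s * (n + y - c)) : False := by
  rcases le_total s (7 / 6) with e | e
  · linarith [mul_nonneg (sub_nonneg.2 e) hn.le, mul_nonneg (sub_nonneg.2 hs) hv,
      mul_nonneg (sub_nonneg.2 hs) ha, mul_nonneg (sub_nonneg.2 hs) hc,
      mul_nonneg (sub_nonneg.2 e) hy, mul_nonneg (sub_nonneg.2 hs) hz]
  rcases le_total s (5 / 4) with f | f
  · linarith [mul_nonneg (sub_nonneg.2 f) hn.le, mul_nonneg (sub_nonneg.2 e) hv,
      mul_nonneg (sub_nonneg.2 e) ha, mul_nonneg (sub_nonneg.2 e) hc,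
      mul_nonneg (sub_nonneg.2 f) hy, mul_nonneg (sub_nonneg.2 e) hz]
  rcases le_total s (13 / 10) with g | g
  · linarith [mul_nonneg (sub_nonneg.2 g) hn.le, mul_nonneg (sub_nonneg.2 f) hv,
      mul_nonneg (sub_nonneg.2 f) ha, mul_nonneg (sub_nonneg.2 f) hc,
      mul_nonneg (sub_nonneg.2 g) hy, mul_nonneg (sub_nonneg.2 f) hz]
  linarith [mul_nonneg (sub_nonneg.2 hs') hn.le, mul_nonneg (sub_nonneg.2 g) hv,
    mul_nonneg (sub_nonneg.2 g) ha, mul_nonneg (sub_nonneg.2 g) hc,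
    mul_nonneg (sub_nonneg.2 hs') hy, mul_nonneg (sub_nonneg.2 g) hz]

theorem infeasible_true_run_lt_of_ge {s n t v a c y z : ℝ} (hn : 0 < n) (hv : 0 ≤ v)
    (hc : 0 ≤ c) (hy : 0 ≤ y) (hz : 0 ≤ z) (hs : 1 ≤ s) (hs' : s ≤ 4 / 3)
    (hp : t + a + c ≤ s * n) (hac : n ≤ a + c) (h₁ : (8 / 25 + s / 2) * (n + v) ≤ t + a)
    (h₂ : (8 / 25 + s / 2) * (n + y - c) ≤ t + v + a + c) (h₃ : a + z ≤ y - c) : False := by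
  linarith [hz, mul_nonneg (sub_nonneg.2 hs') hn.le, mul_nonneg (sub_nonneg.2 hs) hv,
    mul_nonneg (sub_nonneg.2 hs') hc, mul_nonneg (sub_nonneg.2 hs) hy]

theorem infeasible_run_le {s n t v a c y : ℝ} (hn : 0 < n) (hv : 0 ≤ v) (hc : 0 ≤ c)
    (hy : 0 ≤ y) (hs : 1 ≤ s) (hs' : s ≤ 4 / 3) (hp : t + a + c ≤ s * n) (hac : n ≤ a + c)
    (h₁ : (8 / 25 + s / 2) * (n + y - c) ≤ t + v + c)
    (h₂ : (8 / 25 + s / 2) * (n + v + y) ≤ t + a + y) (h₃ : 2 * c ≤ y) : False := by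
  linarith [mul_nonneg (sub_nonneg.2 hs') hn.le, mul_nonneg (sub_nonneg.2 hs) hv,
    mul_nonneg (sub_nonneg.2 hs') hc, mul_nonneg (sub_nonneg.2 hs) hy]

theorem infeasible_run_lt_of_le {s n t v a c y z : ℝ} (hn : 0 < n) (hv : 0 ≤ v) (hc : 0 ≤ c)
    (hy : 0 ≤ y) (hz : 0 ≤ z) (hs : 1 ≤ s) (hs' : s ≤ 4 / 3) (hp : t + a + c ≤ s * n)
    (hac : n ≤ a + c) (hva : v ≤ a) (h₁ : (8 / 25 + s / 2) * (n + y - c) ≤ t + v + c)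
    (h₂ : (8 / 25 + s / 2) * (n + v + z) ≤ t + a + y) (h₃ : 2 * c ≤ y)
    (h₄ : t + a + c + 2 * (y - c) - z ≤ s * (n + y - c)) : False := by
  linarith [mul_nonneg (sub_nonneg.2 hs') hn.le, mul_nonneg (sub_nonneg.2 hs) hv,
    mul_nonneg (sub_nonneg.2 hs) hc, mul_nonneg (sub_nonneg.2 hs') hy,
    mul_nonneg (sub_nonneg.2 hs) hz]

theorem infeasible_run_lt_of_ge {s n t v a c y z : ℝ} (hn : 0 < n) (hc : 0 ≤ c) (hy : 0 ≤ y)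
    (hz : 0 ≤ z) (hs : 1 ≤ s) (hs' : s ≤ 4 / 3) (hp : t + a + c ≤ s * n) (hac : n ≤ a + c)
    (hva : v ≤ a) (h₁ : (8 / 25 + s / 2) * (n + y - c) ≤ t + v + c) (h₂ : 2 * c ≤ y)
    (h₃ : v + z ≤ y - c) : False := by
  rcases le_total s (7 / 6) with e | e
  · linarith [hz, mul_nonneg (sub_nonneg.2 e) hn.le, mul_nonneg (sub_nonneg.2 e) hc,
      mul_nonneg (sub_nonneg.2 hs) hy]
  linarith [hz, mul_nonneg (sub_nonneg.2 hs') hn.le, mul_nonneg (sub_nonneg.2 hs') hc,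
    mul_nonneg (sub_nonneg.2 e) hy]

theorem infeasible_false_true_false {s n t v a c : ℝ} (hn : 0 < n) (hv : 0 ≤ v) (hc : 0 ≤ c)
    (hs : 1 ≤ s) (hs' : s ≤ 4 / 3) (hp : t + a + c ≤ s * n) (hac : n ≤ a + c)
    (h₁ : (8 / 25 + s / 2) * n ≤ t + v + c) (h₂ : (8 / 25 + s / 2) * (n + v + c) ≤ t + c + a)
    : False := by
  linarith [mul_nonneg (sub_nonneg.2 hs') hn.le, mul_nonneg (sub_nonneg.2 hs) hv,
    mul_nonneg (sub_nonneg.2 hs) hc]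

theorem infeasible_false_run_le {s n t v a c y : ℝ} (hn : 0 < n) (hv : 0 ≤ v) (ha : 0 ≤ a)
    (hc : 0 ≤ c) (hy : 0 ≤ y) (hs : 1 ≤ s) (hs' : s ≤ 4 / 3) (hp : t + a + c ≤ s * n)
    (hac : n ≤ a + c) (h₁ : (8 / 25 + s / 2) * (n + y - a) ≤ t + v + a + c)
    (h₂ : (8 / 25 + s / 2) * (n + v + c + y) ≤ t + c + y) : False := by
  linarith [mul_nonneg (sub_nonneg.2 hs') hn.le, mul_nonneg (sub_nonneg.2 hs) hv,
    mul_nonneg (sub_nonneg.2 hs') ha, mul_nonneg (sub_nonneg.2 hs) hc,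
    mul_nonneg (sub_nonneg.2 hs) hy]

theorem infeasible_false_run_lt {s n t v a c y z : ℝ} (hn : 0 < n) (hv : 0 ≤ v) (ha : 0 ≤ a)
    (hc : 0 ≤ c) (hy : 0 ≤ y) (hz : 0 ≤ z) (hs : 1 ≤ s) (hs' : s ≤ 4 / 3)
    (hp : t + a + c ≤ s * n) (hac : n ≤ a + c) (h₁ : (8 / 25 + s / 2) * (n + v) ≤ t + a + c)
    (h₂ : (8 / 25 + s / 2) * (n + y - a) ≤ t + v + a + c)
    (h₃ : (8 / 25 + s / 2) * (n + v + c + z) ≤ t + c + y) (h₄ : a ≤ z) : False := by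
  rcases le_total s (7 / 6) with e | e
  · linarith [mul_nonneg (sub_nonneg.2 e) hn.le, mul_nonneg (sub_nonneg.2 hs) hv,
      mul_nonneg (sub_nonneg.2 e) ha, mul_nonneg (sub_nonneg.2 hs) hc,
      mul_nonneg (sub_nonneg.2 hs) hy, mul_nonneg (sub_nonneg.2 hs) hz]
  linarith [mul_nonneg (sub_nonneg.2 hs') hn.le, mul_nonneg (sub_nonneg.2 e) hv,
    mul_nonneg (sub_nonneg.2 hs') ha, mul_nonneg (sub_nonneg.2 e) hc,
    mul_nonneg (sub_nonneg.2 e) hy, mul_nonneg (sub_nonneg.2 e) hz]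

theorem infeasible_false_run_zero_of_le {s n t v a c y : ℝ} (hn : 0 < n) (hv : 0 ≤ v)
    (ha : 0 ≤ a) (hc : 0 ≤ c) (hy : 0 ≤ y) (hs : 1 ≤ s) (hs' : s ≤ 4 / 3) (hac : n ≤ a + c)
    (h₁ : (8 / 25 + s / 2) * (n + v) ≤ t + a + c)
    (h₂ : (8 / 25 + s / 2) * (n + y - a) ≤ t + v + a + c)
    (h₃ : (8 / 25 + s / 2) * (n + v + c) ≤ t + c + y) (h₄ : 2 * a ≤ y)
    (h₅ : t + a + c + 2 * (y - a) ≤ s * (n + y - a)) : False := by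
  linarith [mul_nonneg (sub_nonneg.2 hs') hn.le, mul_nonneg (sub_nonneg.2 hs) hv,
    mul_nonneg (sub_nonneg.2 hs) ha, mul_nonneg (sub_nonneg.2 hs) hc,
    mul_nonneg (sub_nonneg.2 hs') hy]

theorem infeasible_false_run_zero_of_ge {s n t v a c : ℝ} (hn : 0 < n) (ht : 0 ≤ t) (hv : 0 ≤ v)
    (hc : 0 ≤ c) (hs' : s ≤ 4 / 3) (hac : n ≤ a + c) (h₁ : (8 / 25 + s / 2) * n ≤ t + v + c)
    (h₂ : t + a + c + 2 * (v + c) ≤ s * (n + v + c)) : False := by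
  linarith [ht, mul_nonneg (sub_nonneg.2 hs') hn.le, mul_nonneg (sub_nonneg.2 hs') hv,
    mul_nonneg (sub_nonneg.2 hs') hc]

end Bounds

/-- The two agreements are cut on the left to the common length `n + H`, which leaves the diverging
letters at their right ends in place. -/
theorem complexity_add_two_mul_min_le {α : Type*} [Finite α] {x : ℕ → α}
    (hx : ¬ UltimatelyPeriodic x) {n H g f₁ f₁' H₁ f₂ f₂' H₂ : ℕ} (h₁ : H ≤ H₁) (h₂ : H ≤ H₂)
    (he₁ : factor x f₁ (n + H₁) = factor x f₁' (n + H₁))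
    (he₂ : factor x f₂ (n + H₂) = factor x f₂' (n + H₂))
    (hn₁ : x (f₁ + H₁ + n) ≠ x (f₁' + H₁ + n)) (hn₂ : x (f₂ + H₂ + n) ≠ x (f₂' + H₂ + n))
    (hg : 0 < g) (hne : g ≤ H → x (f₁' + H₁ - g) ≠ x (f₂' + H₂ - g)) :
    complexity n x + 2 * H ≤ complexity (n + H) x + g := by
  have aux : ∀ f f' H', H ≤ H' → factor x f (n + H') = factor x f' (n + H') →
      factor x (f + H' - H) (n + H) = factor x (f' + H' - H) (n + H) := by
    intro f f' H' hH h
    have := factor_add_eq (i := f) (j := f') (m := H' - H) (n := n + H)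
      (by rwa [show H' - H + (n + H) = n + H' by omega])
    rwa [← Nat.add_sub_assoc hH, ← Nat.add_sub_assoc hH] at this
  exact complexity_add_two_mul_le hx (by omega) (by omega) (by omega) (by omega)
    (aux _ _ _ h₁ he₁) (aux _ _ _ h₂ he₂) hn₁ hn₂ hg hne

/-! ### Case analysis on the first runs of the coding sequence. -/

namespace ReturnCoding

variable {α : Type*} {x : ℕ → α} {n : ℕ} {len : Bool → ℕ} {q : ℕ → ℕ} {d : ℕ → Bool}

theorem q_add_run (C : ReturnCoding x n len q d) {i k : ℕ} {s : Bool}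
    (h : ∀ m < k, d (i + m) = s) : q (i + k) = q i + k * len s := by
  induction k with
  | zero => simp
  | succ k ih =>
    rw [← add_assoc, C.q_succ, ih fun m hm => h m (by omega), h k (by omega)]
    ring

theorem factor_run (C : ReturnCoding x n len q d) {i j k : ℕ} {s : Bool}
    (hi : ∀ m < k, d (i + m) = s) (hj : ∀ m < k, d (j + m) = s) :
    factor x (q i) (n + k * len s) = factor x (q j) (n + k * len s) := by
  induction k with
  | zero => exact factor_eq_of_le (C.factor_eq i j) (by simp)
  | succ k ih =>
    have h1 := ih (fun m hm => hi m (by omega)) (fun m hm => hj m (by omega))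
    have h2 := C.agree (i + k) (j + k) ((hi k (by omega)).trans (hj k (by omega)).symm)
    rw [hi k (by omega), C.q_add_run fun m hm => hi m (by omega : m < k + 1),
      C.q_add_run fun m hm => hj m (by omega : m < k + 1)] at h2
    have h3 := factor_append_eq (factor_eq_of_le h1 (by omega)) h2
    rwa [show k * len s + (n + len s) = n + (k + 1) * len s by ring] at h3

theorem factor_cons_run (C : ReturnCoding x n len q d) {i j k : ℕ} {s s' : Bool}
    (hi₀ : d i = s') (hj₀ : d j = s') (hi : ∀ m < k, d (i + 1 + m) = s)
    (hj : ∀ m < k, d (j + 1 + m) = s) :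
    factor x (q i) (n + (len s' + k * len s)) = factor x (q j) (n + (len s' + k * len s)) := by
  have h1 := C.agree i j (hi₀.trans hj₀.symm)
  have h2 := C.factor_run hi hj
  rw [C.q_succ, C.q_succ, hi₀, hj₀] at h2
  rw [hi₀] at h1
  have h3 := factor_append_eq (factor_eq_of_le h1 (by omega)) h2
  rwa [show len s' + (n + k * len s) = n + (len s' + k * len s) by ring] at h3

theorem exists_run (C : ReturnCoding x n len q d) (i : ℕ) (s : Bool) :
    ∃ k, (∀ m < k, d (i + m) = !s) ∧ d (i + k) = s := by
  classical
  have h : ∃ k, d (i + k) = s := by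
    obtain ⟨j, hj, hs⟩ := C.exists_ge i s
    exact ⟨j - i, by rwa [show i + (j - i) = j by omega]⟩
  refine ⟨Nat.find h, fun m hm => ?_, Nat.find_spec h⟩
  have := Nat.find_min h hm
  revert this
  cases d (i + m) <;> cases s <;> simp

namespace WithTail

variable {t v : ℕ} {s : Bool}

/-- Renaming the return words, one may assume that the tail is of type `true`. -/
theorem swap (T : WithTail x n len q d t v s) :
    WithTail x n (fun s => len (!s)) q (fun i => !d i) t v (!s) where
  len_pos s := T.len_pos _
  q_succ i := by simpa using T.q_succ i
  agree i j h := factor_eq_of_le (T.agree i j (by simpa using h)) (by simp)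
  letter_ne i j h := T.letter_ne i j (by simpa using h)
  factor_eq := T.factor_eq
  exists_ge N s := by
    obtain ⟨i, hi, h⟩ := T.exists_ge N (!s)
    exact ⟨i, hi, by simp [h]⟩
  mem := T.mem
  special := T.special
  last_ne i j h := T.last_ne i j (by simpa using h)
  q_zero := T.q_zero
  le_len := by simpa using T.le_len
  tail i h := T.tail i (by simpa using h)
  card_le := by
    have := T.card_le
    simp only [Bool.not_true, Bool.not_false]
    omega
  lt_len := by
    have := T.lt_len
    simp only [Bool.not_true, Bool.not_false]
    omega

theorem factor_tail (T : WithTail x n len q d t v s) {i L : ℕ} (hi : d i = s)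
    (h : factor x (q 0) (n + L) = factor x (q (i + 1)) (n + L)) :
    factor x t (n + (v + L)) = factor x (q (i + 1) - v) (n + (v + L)) := by
  have h1 := T.q_succ i
  have h2 := T.le_len
  rw [hi] at h1
  have h3 := factor_append_eq (i := t) (j := q (i + 1) - v) (m := v) (n := n + L)
    (factor_eq_of_le (T.tail i hi) (by omega))
    (by rwa [← T.q_zero, Nat.sub_add_cancel (by omega)])
  rwa [show v + (n + L) = n + (v + L) by ring] at h3

/-- The inequalities that are played off against each other: a lower bound for the repetition
function and an upper bound for the complexity. -/
structure Bounds (x : ℕ → α) (n t v a c : ℕ) (σ : ℝ) : Prop where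
  pos : (0 : ℝ) < n
  one_le : 1 ≤ σ
  le : σ ≤ 4 / 3
  add_le : (t : ℝ) + a + c ≤ σ * n
  le_add : (n : ℝ) ≤ a + c
  le_len : (v : ℝ) ≤ a
  rep : ∀ {i m L : ℕ}, i < m → factor x i (n + L) = factor x m (n + L) →
    (8 / 25 + σ / 2) * ((n : ℝ) + L) ≤ m
  comp : ∀ H g : ℕ, complexity n x + 2 * H ≤ complexity (n + H) x + (g + 1) →
    (t : ℝ) + a + c + 2 * H - g ≤ σ * (n + H)

variable {σ : ℝ}

theorem bounds (T : WithTail x n len q d t v true)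
    (hσ : 1 ≤ σ) (hσ' : σ ≤ 4 / 3) (hp : ∀ m ≥ n, (complexity m x : ℝ) + 2 ≤ σ * m)
    (hr : ∀ m ≥ n, (8 / 25 + σ / 2) * (m : ℝ) ≤ repetition m x) :
    Bounds x n t v (len true) (len false) σ := by
  -- The margin `2` in `hp` pays for the `+ 1` in `card_le` and for the one in `g + 1`.
  have hcomp : ∀ H g : ℕ, complexity n x + 2 * H ≤ complexity (n + H) x + (g + 1) →
      (t : ℝ) + len true + len false + 2 * H - g ≤ σ * (n + H) := by
    intro H g h
    have h1 := hp (n + H) (by omega)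
    have h2 : ((t + len true + len false : ℕ) : ℝ) + ((2 * H : ℕ) : ℝ) ≤
        ((complexity (n + H) x : ℕ) : ℝ) + ((g + 2 : ℕ) : ℝ) := by
      have := T.card_le
      exact_mod_cast (by omega : t + len true + len false + 2 * H ≤
        complexity (n + H) x + (g + 2))
    push_cast at h1 h2
    linarith
  refine ⟨?_, hσ, hσ', by simpa using hcomp 0 0 (by simp), ?_, Nat.cast_le.2 T.le_len, ?_, hcomp⟩
  · rcases n.eq_zero_or_pos with h | h
    · have h1 := hp n le_rfl
      have h2 : (0 : ℝ) ≤ complexity n x := Nat.cast_nonneg _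
      rw [h, Nat.cast_zero, mul_zero] at h1
      rw [h] at h2
      linarith
    · exact Nat.cast_pos.2 h
  · exact_mod_cast (by have := T.lt_len; omega : n ≤ len true + len false)
  · intro i m L him h
    have h1 := hr (n + L) (by omega)
    have h2 : ((repetition (n + L) x : ℕ) : ℝ) ≤ m := Nat.cast_le.2 (repetition_le him h)
    push_cast at h1
    linarith

variable [Finite α]

/-- Writing `T` and `F` for the symbols, `d` starts with `T T` or with `T F^(j+1) T F^i T`.
Repetitions come from the tail against the end of the first `T`, from the run `F^(j+1)` shifted by
one `F`, and from the two words `T F^e`. If `i ≤ j`, the contexts `F^j` and `T F^i` are both right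
special; read leftwards from the last return position, they part just beyond `F^i`, whence `g = i c
+ 1`. -/
theorem false_of_true (hx : ¬ UltimatelyPeriodic x) (T : WithTail x n len q d t v true)
    (B : Bounds x n t v (len true) (len false) σ) (h0 : d 0 = true) : False := by
  obtain ⟨hn, hσ, hσ', hpn, hac, -, -, -⟩ := id B
  have apos := T.len_pos true
  have cpos := T.len_pos false
  have q0 := T.q_zero
  have hmono := T.q_strictMono
  have q1 := T.q_succ 0
  have q2 := T.q_succ 1
  rw [zero_add] at q1
  rw [one_add_one_eq_two] at q2
  set a := len true with ha
  set c := len false with hc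
  have a0 : (0 : ℝ) ≤ a := Nat.cast_nonneg _
  have c0 : (0 : ℝ) ≤ c := Nat.cast_nonneg _
  have v0 : (0 : ℝ) ≤ v := Nat.cast_nonneg _
  rw [h0, ← ha] at q1
  -- the first return word matches the tail
  have hb : ∀ L, factor x (q 0) (n + L) = factor x (q 1) (n + L) →
      (8 / 25 + σ / 2) * ((n : ℝ) + (v + L)) ≤ t + a := by
    intro L h
    have h2 := T.factor_tail (i := 0) h0 h
    rw [zero_add, show q 1 - v = t + a by omega] at h2
    have := B.rep (by omega) h2
    exact_mod_cast this
  cases h1 : d 1 with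
  | true =>
    refine infeasible_true_true hn v0 a0 c0 hσ hσ' hpn hac ?_
    have := T.agree 0 1 (h0.trans h1.symm)
    rw [h0] at this
    have := hb a this
    linarith
  | false =>
    have hbv := hb 0 (T.factor_eq 0 1)
    rw [h1, ← hc] at q2
    obtain ⟨j', hj, hj'⟩ := T.exists_run 1 true
    simp only [Bool.not_true] at hj
    obtain ⟨j, rfl⟩ : ∃ j, j' = j + 1 := Nat.exists_eq_succ_of_ne_zero fun h => by
      rw [h, add_zero, h1] at hj'
      exact Bool.noConfusion hj'
    obtain ⟨i, hi, hi'⟩ := T.exists_run (j + 3) true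
    simp only [Bool.not_true] at hi
    have qj : ∀ k ≤ j + 1, q (1 + k) = q 1 + k * c := fun k hk =>
      T.q_add_run fun m hm => hj m (by omega)
    have qj2 := qj (j + 1) le_rfl
    rw [show 1 + (j + 1) = j + 2 by omega] at qj2 hj'
    have qj3 := T.q_succ (j + 2)
    rw [hj', ← ha, show j + 2 + 1 = j + 3 by omega] at qj3
    have run₁ : factor x (q 1) (n + j * c) = factor x (q 2) (n + j * c) :=
      T.factor_run (fun m hm => hj m (by omega)) fun m hm => by
        have := hj (m + 1) (by omega)
        rwa [show 1 + (m + 1) = 2 + m by omega] at this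
    have hbj := B.rep (by omega) run₁
    have run₂ : ∀ e ≤ i, e ≤ j + 1 → factor x (q 0) (n + (a + e * c)) =
        factor x (q (j + 2)) (n + (a + e * c)) := fun e hei hej =>
      T.factor_cons_run h0 hj' (fun m hm => by
        rw [zero_add]; exact hj m (by omega)) (fun m hm => hi m (by omega))
    have hbe := fun e (hei : e ≤ i) (hej : e ≤ j + 1) =>
      B.rep (hmono (by omega : 0 < j + 2)) (run₂ e hei hej)
    have jc0 : (0 : ℝ) ≤ j * c := by positivity
    have ic0 : (0 : ℝ) ≤ i * c := by positivity
    have e1 : (q (j + 2) : ℝ) = t + v + a + (j + 1) * c := by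
      rw [qj2, q1, q0]; push_cast; ring
    have e2 : (q 2 : ℝ) = t + v + a + c := by
      rw [q2, q1, q0]; push_cast; ring
    rw [e2] at hbj
    rw [e1] at hbe
    push_cast at hbj hbe hbv
    rcases le_or_gt (j + 1) i with hij | hij
    · have := hbe (j + 1) hij le_rfl
      push_cast at this
      exact infeasible_true_run_le (y := (j + 1) * c) hn v0 a0 c0 (by positivity) hσ hσ' hpn
        hac (by linarith) (by linarith) (by linarith)
    · have hbi := hbe i le_rfl hij.le
      -- The shorter agreement limits the growth by two. If it is the second one, the repetitions
      -- suffice and no complexity estimate is needed.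
      rcases le_total (j * c) (a + i * c) with hH | hH
      · have key := complexity_add_two_mul_min_le hx (g := i * c + 1) le_rfl hH run₁
          (run₂ i le_rfl hij.le) ?_ ?_ (by omega) ?_
        · have := B.comp _ _ key
          push_cast at this
          exact infeasible_true_run_lt_of_le (y := (j + 1) * c) (z := i * c) hn v0 a0 c0
            (by positivity) ic0 hσ hσ' hpn hac (by linarith) (by linarith) (by linarith)
            (by linarith)
        · rw [← qj j (by omega)]
          have : q 2 + j * c = q (j + 2) := by rw [q2, qj2]; ring
          rw [this]
          exact T.letter_ne _ _ (by rw [hj j (by omega), hj']; simp)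
        · have h3 : q 0 + (a + i * c) = q (1 + i) := by rw [qj i hij.le, q1]; ring
          have h4 : q (j + 2) + (a + i * c) = q (j + 3 + i) := by
            rw [T.q_add_run hi, qj3]; ring
          rw [h3, h4]
          exact T.letter_ne _ _ (by rw [hj i hij, hi']; simp)
        · intro _
          have h3 : q 2 + j * c - (i * c + 1) = q (j + 1 - i + 1) - 1 := by
            have := qj (j + 1 - i) (by omega)
            rw [show 1 + (j + 1 - i) = j + 1 - i + 1 by omega] at this
            have h4 : (j + 1 - i) * c + i * c = c + j * c := by
              rw [← add_mul, Nat.sub_add_cancel hij.le]; ring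
            omega
          have h4 : q (j + 2) + (a + i * c) - (i * c + 1) = q (j + 2 + 1) - 1 := by
            rw [show j + 2 + 1 = j + 3 by omega]
            omega
          rw [h3, h4]
          refine T.last_ne _ _ ?_
          have := hj (j - i) (by omega)
          rw [show 1 + (j - i) = j + 1 - i by omega] at this
          rw [this, hj']
          simp
      · have hH' : (a : ℝ) + i * c ≤ j * c := by exact_mod_cast hH
        exact infeasible_true_run_lt_of_ge (y := (j + 1) * c) (z := i * c) hn v0
          c0 (by positivity) ic0 hσ hσ' hpn hac (by linarith) (by linarith) (by linarith)

/-- Here `d` starts with `F^(j+2) T F^i T`. The long run repeats under a shift by one `F`, and the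
tail followed by `F^e` recurs at the end of the first `T`. If `i ≤ j + 1`, these two agreements
again part just beyond `F^i`. -/
theorem false_of_false_false (hx : ¬ UltimatelyPeriodic x) (T : WithTail x n len q d t v true)
    (B : Bounds x n t v (len true) (len false) σ) (h0 : d 0 = false) (h1 : d 1 = false) :
    False := by
  obtain ⟨hn, hσ, hσ', hpn, hac, hva, -, -⟩ := id B
  have apos := T.len_pos true
  have cpos := T.len_pos false
  have q0 := T.q_zero
  have q1 := T.q_succ 0
  rw [zero_add] at q1
  set a := len true with ha
  set c := len false with hc
  have c0 : (0 : ℝ) ≤ c := Nat.cast_nonneg _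
  have v0 : (0 : ℝ) ≤ v := Nat.cast_nonneg _
  rw [h0, ← hc] at q1
  obtain ⟨j', hj, hj'⟩ := T.exists_run 0 true
  simp only [Bool.not_true, zero_add] at hj hj'
  obtain ⟨j, rfl⟩ : ∃ j, j' = j + 2 := by
    refine ⟨j' - 2, ?_⟩
    have : j' ≠ 0 := by rintro rfl; simp [h0] at hj'
    have : j' ≠ 1 := by rintro rfl; simp [h1] at hj'
    omega
  obtain ⟨i, hi, hi'⟩ := T.exists_run (j + 3) true
  simp only [Bool.not_true] at hi
  have qj : ∀ k ≤ j + 2, q k = q 0 + k * c := fun k hk => by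
    have := T.q_add_run (i := 0) (k := k) (s := false) fun m hm => by
      rw [zero_add]; exact hj m (by omega)
    rwa [zero_add] at this
  have qj2 := qj (j + 2) le_rfl
  have qj3 := T.q_succ (j + 2)
  rw [hj', ← ha, show j + 2 + 1 = j + 3 by omega] at qj3
  have run₁ : factor x (q 0) (n + (j + 1) * c) = factor x (q 1) (n + (j + 1) * c) :=
    T.factor_run (fun m hm => by rw [zero_add]; exact hj m (by omega)) fun m hm => by
      rw [add_comm]; exact hj (m + 1) (by omega)
  have hbj := B.rep (by omega) run₁
  have run₂ : ∀ e ≤ i, e ≤ j + 2 → factor x t (n + (v + e * c)) =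
      factor x (q (j + 3) - v) (n + (v + e * c)) := fun e hei hej =>
    T.factor_tail (i := j + 2) hj' (T.factor_run (fun m hm => by
      rw [zero_add]; exact hj m (by omega)) fun m hm => hi m (by omega))
  have hva' := T.le_len
  have e3 : q (j + 3) - v = t + ((j + 2) * c + a) := by omega
  have hbe := fun e (hei : e ≤ i) (hej : e ≤ j + 2) => B.rep (by omega) (run₂ e hei hej)
  have jc0 : (0 : ℝ) ≤ j * c := by positivity
  have ic0 : (0 : ℝ) ≤ i * c := by positivity
  have e2 : (q 1 : ℝ) = t + v + c := by
    rw [q1, q0]; push_cast; ring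
  rw [e2] at hbj
  rw [e3] at hbe
  push_cast at hbj hbe
  rcases le_or_gt (j + 2) i with hij | hij
  · have := hbe (j + 2) hij le_rfl
    push_cast at this
    exact infeasible_run_le (y := (j + 2) * c) hn v0 c0 (by positivity) hσ hσ' hpn hac
      (by linarith) (by linarith) (by linarith)
  · have hbi := hbe i le_rfl hij.le
    rcases le_total ((j + 1) * c) (v + i * c) with hH | hH
    · have key := complexity_add_two_mul_min_le hx (g := i * c + 1) le_rfl hH run₁
        (run₂ i le_rfl hij.le) ?_ ?_ (by omega) ?_
      · have := B.comp _ _ key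
        push_cast at this
        exact infeasible_run_lt_of_le (y := (j + 2) * c) (z := i * c) hn v0 c0
          (by positivity) ic0 hσ hσ' hpn hac hva (by linarith) (by linarith) (by linarith)
          (by linarith)
      · have : q 1 + (j + 1) * c = q (j + 2) := by rw [q1, qj2]; ring
        rw [← qj (j + 1) (by omega), this]
        exact T.letter_ne _ _ (by rw [hj (j + 1) (by omega), hj']; simp)
      · have h3 : t + (v + i * c) = q i := by rw [qj i hij.le, q0]; ring
        have h4 : q (j + 3) - v + (v + i * c) = q (j + 3 + i) := by
          rw [T.q_add_run hi, ← hc]; omega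
        rw [h3, h4]
        exact T.letter_ne _ _ (by rw [hj i hij, hi']; simp)
      · intro _
        have h3 : q 1 + (j + 1) * c - (i * c + 1) = q (j + 1 - i + 1) - 1 := by
          have := qj (j + 1 - i + 1) (by omega)
          have h4 : (j + 1 - i + 1) * c + i * c = c + (j + 1) * c := by
            rw [← add_mul, show j + 1 - i + 1 + i = 1 + (j + 1) by omega]; ring
          omega
        have h4 : q (j + 3) - v + (v + i * c) - (i * c + 1) = q (j + 2 + 1) - 1 := by
          rw [show j + 2 + 1 = j + 3 by omega]
          omega
        rw [h3, h4]
        refine T.last_ne _ _ ?_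
        rw [hj (j + 1 - i) (by omega), hj']
        simp
    · have hH' : (v : ℝ) + i * c ≤ (j + 1) * c := by exact_mod_cast hH
      exact infeasible_run_lt_of_ge (y := (j + 2) * c) (z := i * c) hn c0
        (by positivity) ic0 hσ hσ' hpn hac hva (by linarith) (by linarith) (by linarith)

/-- Here `d` starts with `F T^(k+1) F T^i F`, and the tail followed by `F T^e` recurs at the end of
the last `T` of the first run. Only `i = 0 < k` needs the complexity: the two special contexts then
end in `T` and in `F`, so they part at once and `g = 1`. -/
theorem false_of_false_true (hx : ¬ UltimatelyPeriodic x) (T : WithTail x n len q d t v true)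
    (B : Bounds x n t v (len true) (len false) σ) (h0 : d 0 = false) (h1 : d 1 = true) :
    False := by
  obtain ⟨hn, hσ, hσ', hpn, hac, -, -, -⟩ := id B
  have apos := T.len_pos true
  have cpos := T.len_pos false
  have q0 := T.q_zero
  have hmono := T.q_strictMono
  have q1 := T.q_succ 0
  have q2 := T.q_succ 1
  rw [zero_add] at q1
  rw [one_add_one_eq_two] at q2
  set a := len true with ha
  set c := len false with hc
  have a0 : (0 : ℝ) ≤ a := Nat.cast_nonneg _
  have c0 : (0 : ℝ) ≤ c := Nat.cast_nonneg _
  have v0 : (0 : ℝ) ≤ v := Nat.cast_nonneg _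
  have t0 : (0 : ℝ) ≤ t := Nat.cast_nonneg _
  rw [h0, ← hc] at q1
  rw [h1, ← ha] at q2
  obtain ⟨k', hk, hk'⟩ := T.exists_run 1 false
  simp only [Bool.not_false] at hk
  obtain ⟨k, rfl⟩ : ∃ k, k' = k + 1 := Nat.exists_eq_succ_of_ne_zero fun h => by
    rw [h, add_zero, h1] at hk'
    exact Bool.noConfusion hk'
  obtain ⟨i, hi, hi'⟩ := T.exists_run (k + 3) false
  simp only [Bool.not_false] at hi
  have qk : ∀ m ≤ k + 1, q (1 + m) = q 1 + m * a := fun m hm =>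
    T.q_add_run fun m' hm' => hk m' (by omega)
  have qk2 := qk (k + 1) le_rfl
  rw [show 1 + (k + 1) = k + 2 by omega] at qk2 hk'
  have hk₁ : d (k + 1) = true := by
    rw [add_comm]; exact hk k (by omega)
  have qk3 := T.q_succ (k + 2)
  rw [hk', ← hc, show k + 2 + 1 = k + 3 by omega] at qk3
  have hva' := T.le_len
  have run₁ : factor x (q 1) (n + k * a) = factor x (q 2) (n + k * a) :=
    T.factor_run (fun m hm => hk m (by omega)) fun m hm => by
      have := hk (m + 1) (by omega)
      rwa [show 1 + (m + 1) = 2 + m by omega] at this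
  have run₂ : ∀ e ≤ i, e ≤ k + 1 → factor x t (n + (v + (c + e * a))) =
      factor x (q (k + 2) - v) (n + (v + (c + e * a))) := fun e hei hek =>
    T.factor_tail (i := k + 1) hk₁ (T.factor_cons_run h0 hk' (fun m hm => by
      rw [zero_add]; exact hk m (by omega)) fun m hm => hi m (by omega))
  have e3 : q (k + 2) - v = t + (c + (k + 1) * a) := by omega
  have e4 : q 2 - v = t + c + a := by omega
  have e1 : (q 1 : ℝ) = t + v + c := by rw [q1, q0]; push_cast; ring
  have e2 : (q 2 : ℝ) = t + v + c + a := by rw [q2, q1, q0]; push_cast; ring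
  have hb0 := B.rep (L := 0) (hmono Nat.zero_lt_one) (T.factor_eq 0 1)
  have htv := T.factor_tail (i := 1) (L := 0) h1 (T.factor_eq 0 2)
  rw [one_add_one_eq_two, e4] at htv
  have hbv := B.rep (by omega) htv
  have hbk := B.rep (hmono one_lt_two) run₁
  have hbe := fun e (hei : e ≤ i) (hek : e ≤ k + 1) => B.rep (by omega) (run₂ e hei hek)
  rw [e1] at hb0
  rw [e2] at hbk
  rw [e3] at hbe
  have hb00 := hbe 0 (Nat.zero_le _) (Nat.zero_le _)
  push_cast at hb0 hbv hbk hbe hb00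
  have ka0 : (0 : ℝ) ≤ k * a := by positivity
  rcases Nat.eq_zero_or_pos k with rfl | hk0
  · rw [Nat.cast_zero] at hb00
    exact infeasible_false_true_false hn v0 c0 hσ hσ' hpn hac (by linarith) (by linarith)
  have hk1 : (1 : ℝ) ≤ k := by exact_mod_cast hk0
  have ka1 : (a : ℝ) ≤ k * a := le_mul_of_one_le_left a0 hk1
  rcases le_or_gt (k + 1) i with hik | hik
  · have := hbe (k + 1) hik le_rfl
    push_cast at this
    exact infeasible_false_run_le (y := (k + 1) * a) hn v0 a0 c0 (by positivity) hσ hσ' hpn hac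
      (by linarith) (by linarith)
  rcases Nat.eq_zero_or_pos i with rfl | hi0
  · rw [add_zero] at hi'
    have main : ∀ H, H ≤ k * a → H ≤ v + (c + 0 * a) →
        complexity n x + 2 * H ≤ complexity (n + H) x + (0 + 1) := by
      intro H hH₁ hH₂
      refine complexity_add_two_mul_min_le hx hH₁ hH₂ run₁ (run₂ 0 le_rfl (Nat.zero_le _))
        ?_ ?_ (by omega) ?_
      · have : q 2 + k * a = q (k + 2) := by rw [q2, qk2]; ring
        rw [← qk k (by omega), this]
        exact T.letter_ne _ _ (by rw [hk k (by omega), hk']; simp)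
      · rw [show t + (v + (c + 0 * a)) = q 1 by omega,
          show q (k + 2) - v + (v + (c + 0 * a)) = q (k + 3) by omega]
        exact T.letter_ne _ _ (by rw [h1, hi']; simp)
      · intro _
        have : q 2 + k * a = q (k + 1 + 1) := by
          rw [show k + 1 + 1 = k + 2 by omega, q2, qk2]; ring
        rw [this, show q (k + 2) - v + (v + (c + 0 * a)) = q (k + 2 + 1) by
          rw [show k + 2 + 1 = k + 3 by omega]; omega]
        exact T.last_ne _ _ (by rw [hk₁, hk']; simp)
    rcases le_total (k * a) (v + (c + 0 * a)) with hH | hH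
    · have := B.comp _ _ (main _ le_rfl hH)
      push_cast at this
      exact infeasible_false_run_zero_of_le (t := t) (y := (k + 1) * a) hn v0 a0 c0
        (by positivity) hσ hσ' hac (by linarith) (by linarith) (by linarith) (by linarith) (by linarith)
    · have := B.comp _ _ (main _ hH le_rfl)
      push_cast at this
      exact infeasible_false_run_zero_of_ge hn t0 v0 c0 hσ' hac (by linarith) (by linarith)
  · have hi1 : (1 : ℝ) ≤ i := by exact_mod_cast hi0
    have ia1 : (a : ℝ) ≤ i * a := le_mul_of_one_le_left a0 hi1
    have hbi := hbe i le_rfl hik.le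
    exact infeasible_false_run_lt (y := (k + 1) * a) (z := i * a) hn v0 a0 c0 (by positivity)
      (by positivity) hσ hσ' hpn hac (by linarith) (by linarith) (by linarith) ia1

theorem false_of_growth (hx : ¬ UltimatelyPeriodic x) {s : Bool}
    (T : WithTail x n len q d t v s) (hσ : 1 ≤ σ) (hσ' : σ ≤ 4 / 3)
    (hp : ∀ m ≥ n, (complexity m x : ℝ) + 2 ≤ σ * m)
    (hr : ∀ m ≥ n, (8 / 25 + σ / 2) * (m : ℝ) ≤ repetition m x) : False := by
  have main : ∀ {len d}, WithTail x n len q d t v true → False := by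
    intro len d T
    have B := T.bounds hσ hσ' hp hr
    cases h0 : d 0 with
    | true => exact T.false_of_true hx B h0
    | false =>
      cases h1 : d 1 with
      | true => exact T.false_of_false_true hx B h0 h1
      | false => exact T.false_of_false_false hx B h0 h1
  cases s with
  | true => exact main T
  | false => exact main T.swap

end WithTail

end ReturnCoding

open Filter

/-! ### Rational approximations from repetitions. -/

section Expansion

/-- The number with `b`-ary expansion `0.x_{k+1} x_{k+2} …`. -/
noncomputable def expansionTail {b : ℕ} (x : ℕ → Fin b) (k : ℕ) : ℝ :=
  ∑' j : ℕ, ((x (k + j) : ℕ) : ℝ) / (b : ℝ) ^ (j + 1)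

variable {b : ℕ} {x : ℕ → Fin b}

theorem hasSum_geometric_expansion (hb : 2 ≤ b) :
    HasSum (fun j : ℕ => ((b : ℝ) - 1) / (b : ℝ) ^ (j + 1)) 1 := by
  have hb' : (2 : ℝ) ≤ b := by exact_mod_cast hb
  have h := (hasSum_geometric_of_lt_one (r := (b : ℝ)⁻¹) (by positivity)
    (inv_lt_one_of_one_lt₀ (by linarith))).mul_left (((b : ℝ) - 1) / b)
  have hsum : ((b : ℝ) - 1) / b * (1 - (b : ℝ)⁻¹)⁻¹ = 1 := by
    have : (b : ℝ) - 1 ≠ 0 := by linarith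
    field_simp
  have hterm : (fun j : ℕ => ((b : ℝ) - 1) / (b : ℝ) ^ (j + 1)) =
      fun j => ((b : ℝ) - 1) / b * (b : ℝ)⁻¹ ^ j := by
    funext j
    rw [pow_succ', inv_pow]
    field_simp
  rw [hsum] at h
  rwa [hterm]

theorem digit_le (x : ℕ → Fin b) (k : ℕ) : ((x k : ℕ) : ℝ) ≤ (b : ℝ) - 1 := by
  have := (x k).2
  have : ((x k : ℕ) : ℝ) + 1 ≤ b := by exact_mod_cast this
  linarith

theorem summable_expansionTail (hb : 2 ≤ b) (x : ℕ → Fin b) (k : ℕ) :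
    Summable fun j : ℕ => ((x (k + j) : ℕ) : ℝ) / (b : ℝ) ^ (j + 1) :=
  Summable.of_nonneg_of_le (fun j => by positivity)
    (fun j => div_le_div_of_nonneg_right (digit_le x _) (by positivity))
    (hasSum_geometric_expansion hb).summable

theorem expansionTail_nonneg (x : ℕ → Fin b) (k : ℕ) : 0 ≤ expansionTail x k :=
  tsum_nonneg fun j => by positivity

theorem expansionTail_lt_one (hb : 2 ≤ b) (hx : ¬ UltimatelyPeriodic x) (k : ℕ) :
    expansionTail x k < 1 := by
  obtain ⟨j, hj⟩ : ∃ j, ((x (k + j) : ℕ) : ℝ) < (b : ℝ) - 1 := by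
    by_contra! hcon
    refine hx ⟨k, 1, le_rfl, fun n hn => ?_⟩
    have h1 := le_antisymm (hcon (n - k)) (digit_le x _)
    have h2 := le_antisymm (hcon (n + 1 - k)) (digit_le x _)
    rw [show k + (n - k) = n by omega] at h1
    rw [show k + (n + 1 - k) = n + 1 by omega] at h2
    exact Fin.ext (by exact_mod_cast h2.symm.trans h1)
  have hb0 : (0 : ℝ) < b := by positivity
  rw [← (hasSum_geometric_expansion hb).tsum_eq]
  exact (summable_expansionTail hb x k).tsum_lt_tsum
    (fun j => div_le_div_of_nonneg_right (digit_le x _) (by positivity))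
    (div_lt_div_of_pos_right hj (by positivity)) (hasSum_geometric_expansion hb).summable

theorem expansionTail_eq (hb : 2 ≤ b) (x : ℕ → Fin b) (k : ℕ) :
    b * expansionTail x k = (x k : ℕ) + expansionTail x (k + 1) := by
  have hb0 : (b : ℝ) ≠ 0 := by positivity
  rw [expansionTail, (summable_expansionTail hb x k).tsum_eq_zero_add, mul_add, ← tsum_mul_left,
    expansionTail]
  congr 1
  · simp [mul_div_cancel₀ _ hb0]
  · refine tsum_congr fun j => ?_
    rw [show k + (j + 1) = k + 1 + j by omega, pow_succ' _ (j + 1)]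
    field_simp

/-- All tails lie in `[0, 1)`, so a tail determines its first digit and the next tail; two equal
tails would make `x` ultimately periodic. -/
theorem expansionTail_injective (hb : 2 ≤ b) (hx : ¬ UltimatelyPeriodic x) :
    Function.Injective (expansionTail x) := by
  have step : ∀ k l, expansionTail x k = expansionTail x l →
      x k = x l ∧ expansionTail x (k + 1) = expansionTail x (l + 1) := by
    intro k l h
    have hk := expansionTail_eq hb x k
    have hl := expansionTail_eq hb x l
    rw [h, hl] at hk
    have h1 := expansionTail_nonneg x (k + 1)
    have h2 := expansionTail_nonneg x (l + 1)
    have h3 := expansionTail_lt_one hb hx (k + 1)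
    have h4 := expansionTail_lt_one hb hx (l + 1)
    have h5 : (x k : ℕ) = x l := by
      have h6 : ((x k : ℕ) : ℝ) < (x l : ℕ) + 1 := by linarith
      have h7 : ((x l : ℕ) : ℝ) < (x k : ℕ) + 1 := by linarith
      have h8 : (x k : ℕ) < x l + 1 := by exact_mod_cast h6
      have h9 : (x l : ℕ) < x k + 1 := by exact_mod_cast h7
      omega
    refine ⟨Fin.ext h5, ?_⟩
    rw [h5] at hk
    linarith
  have aux : ∀ k l, k < l → expansionTail x k ≠ expansionTail x l := by
    intro k l hkl h
    have hm : ∀ m, expansionTail x (k + m) = expansionTail x (l + m) := by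
      intro m
      induction m with
      | zero => exact h
      | succ m ih => exact (step _ _ ih).2
    refine hx ⟨k, l - k, by omega, fun n hn => ?_⟩
    have := (step _ _ (hm (n - k))).1
    rw [show k + (n - k) = n by omega, show l + (n - k) = n + (l - k) by omega] at this
    exact this.symm
  intro k l h
  rcases lt_trichotomy k l with hkl | hkl | hkl
  · exact absurd h (aux k l hkl)
  · exact hkl
  · exact absurd h.symm (aux l k hkl)

theorem exists_pow_mul_expansionTail (hb : 2 ≤ b) (x : ℕ → Fin b) (k : ℕ) :
    ∃ P : ℤ, (b : ℝ) ^ k * expansionTail x 0 = P + expansionTail x k := by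
  induction k with
  | zero => exact ⟨0, by simp⟩
  | succ k ih =>
    obtain ⟨P, hP⟩ := ih
    refine ⟨b * P + (x k : ℕ), ?_⟩
    have := expansionTail_eq hb x k
    rw [pow_succ', mul_assoc, hP]
    push_cast
    linarith

theorem pow_mul_expansionTail_sub (hb : 2 ≤ b) {i m n : ℕ}
    (h : factor x i n = factor x m n) :
    (b : ℝ) ^ n * (expansionTail x m - expansionTail x i) =
      expansionTail x (m + n) - expansionTail x (i + n) := by
  induction n with
  | zero => simp
  | succ n ih =>
    obtain ⟨h1, h2⟩ := factor_succ_eq_iff.1 h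
    have e1 := expansionTail_eq hb x (m + n)
    have e2 := expansionTail_eq hb x (i + n)
    rw [h2] at e2
    rw [pow_succ', mul_assoc, ih h1, ← add_assoc, ← add_assoc]
    linarith

/-- With `m = r(n)`, the number `(b^m - b^i) ξ` is an integer plus the difference of two tails that
share `n` digits. So `q = b^m - b^i` has error below `b^(-n) / q`, and `q^(μ-1) ≤ b^((μ-1) m) ≤
b^n`. The last bound, free of `q`, serves to produce infinitely many approximations. -/
theorem exists_rat_approx (hb : 2 ≤ b) (hx : ¬ UltimatelyPeriodic x) (n : ℕ) {μ : ℝ}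
    (hμ : 1 < μ) (h : (μ - 1) * repetition n x ≤ n) :
    ∃ (p : ℤ) (q : ℕ), 1 ≤ q ∧ expansionTail x 0 ≠ (p : ℝ) / q ∧
      |expansionTail x 0 - (p : ℝ) / q| < 1 / (q : ℝ) ^ μ ∧
      |expansionTail x 0 - (p : ℝ) / q| < ((b : ℝ) ^ n)⁻¹ := by
  obtain ⟨⟨hm1, i, him, hfac⟩, -⟩ := isLeast_repetition n x
  set m := repetition n x with hm
  obtain ⟨P, hP⟩ := exists_pow_mul_expansionTail hb x i
  obtain ⟨Q, hQ⟩ := exists_pow_mul_expansionTail hb x m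
  have hpow : b ^ i < b ^ m := Nat.pow_lt_pow_right (by omega) him
  have hb1 : (1 : ℝ) < b := by exact_mod_cast hb
  have hb0 : (0 : ℝ) < b := by linarith
  obtain ⟨q, hq⟩ : ∃ q, b ^ m = b ^ i + q := Nat.exists_eq_add_of_le hpow.le
  have hq1 : 1 ≤ q := by omega
  have hqb : q ≤ b ^ m := by omega
  have hq0 : (0 : ℝ) < q := by exact_mod_cast hq1
  have hqR : (b : ℝ) ^ m = (b : ℝ) ^ i + q := by exact_mod_cast hq
  have hdiff : expansionTail x 0 - ((Q - P : ℤ) : ℝ) / q =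
      (expansionTail x m - expansionTail x i) / q := by
    rw [hqR] at hQ
    push_cast
    field_simp
    linarith
  have hne : expansionTail x m - expansionTail x i ≠ 0 := fun h0 =>
    him.ne (expansionTail_injective hb hx (sub_eq_zero.1 h0)).symm
  have hsmall : |expansionTail x m - expansionTail x i| < ((b : ℝ) ^ n)⁻¹ := by
    have h1 := pow_mul_expansionTail_sub hb hfac.symm
    have h2 : |(b : ℝ) ^ n * (expansionTail x m - expansionTail x i)| < 1 := by
      rw [h1, abs_lt]
      constructor <;>
        linarith [expansionTail_nonneg x (m + n), expansionTail_nonneg x (i + n),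
          expansionTail_lt_one hb hx (m + n), expansionTail_lt_one hb hx (i + n)]
    rw [abs_mul, abs_of_pos (by positivity : (0 : ℝ) < (b : ℝ) ^ n)] at h2
    rwa [← one_div, lt_div_iff₀' (by positivity)]
  refine ⟨Q - P, q, hq1, fun h0 => ?_, ?_, ?_⟩
  · rw [← sub_eq_zero, hdiff] at h0
    exact (div_ne_zero hne hq0.ne') h0
  · rw [hdiff, abs_div, abs_of_pos hq0]
    have h1 : (q : ℝ) ^ (μ - 1) ≤ (b : ℝ) ^ n := by
      calc (q : ℝ) ^ (μ - 1) ≤ ((b : ℝ) ^ m) ^ (μ - 1) :=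
            Real.rpow_le_rpow hq0.le (by exact_mod_cast hqb) (by linarith)
        _ = (b : ℝ) ^ ((μ - 1) * m) := by
            rw [← Real.rpow_natCast, ← Real.rpow_mul hb0.le, mul_comm]
        _ ≤ (b : ℝ) ^ (n : ℝ) := Real.rpow_le_rpow_of_exponent_le hb1.le h
        _ = (b : ℝ) ^ n := Real.rpow_natCast _ _
    have h2 : (q : ℝ) ^ μ = (q : ℝ) ^ (μ - 1) * q := by
      rw [← Real.rpow_add_one hq0.ne', sub_add_cancel]
    have h3 : 0 < (q : ℝ) ^ (μ - 1) := Real.rpow_pos_of_pos hq0 _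
    rw [h2, ← div_div, div_lt_div_iff_of_pos_right hq0, one_div]
    exact hsmall.trans_le (inv_anti₀ h3 h1)
  · rw [hdiff, abs_div, abs_of_pos hq0]
    refine lt_of_le_of_lt (div_le_self (abs_nonneg _) ?_) hsmall
    exact_mod_cast hq1

/-- Finitely many solutions other than `ξ` would keep a positive distance from `ξ`, whereas the
approximations of `exists_rat_approx` differ from `ξ` and come arbitrarily close. -/
theorem le_irrationalityExponent (hb : 2 ≤ b) (hx : ¬ UltimatelyPeriodic x) {μ : ℝ}
    (hμ : 1 < μ) (h : ∃ᶠ n : ℕ in atTop, (μ - 1) * repetition n x ≤ n) :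
    (μ : EReal) ≤ irrationalityExponent (expansionTail x 0) := by
  refine le_sSup ⟨μ, fun hfin => ?_, rfl⟩
  set ξ := expansionTail x 0
  set S : Set ℚ := {s : ℚ | ∃ (p : ℤ) (q : ℕ), 1 ≤ q ∧ s = (p : ℚ) / (q : ℚ) ∧
      |ξ - (p : ℝ) / (q : ℝ)| < 1 / (q : ℝ) ^ μ} with hS
  have hb1 : (1 : ℝ) < b := by exact_mod_cast hb
  -- a positive lower bound for the distance of `ξ` to the elements of `S` other than `ξ`
  obtain ⟨ε, hε, hmin⟩ : ∃ ε > 0, ∀ s ∈ S, (s : ℝ) ≠ ξ → ε ≤ |ξ - s| := by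
    have hfin' : {s ∈ S | (s : ℝ) ≠ ξ}.Finite := hfin.subset fun s hs => hs.1
    rcases {s ∈ S | (s : ℝ) ≠ ξ}.eq_empty_or_nonempty with hemp | hne
    · exact ⟨1, one_pos, fun s hs hsξ =>
        absurd (⟨hs, hsξ⟩ : s ∈ {s ∈ S | (s : ℝ) ≠ ξ}) (Set.eq_empty_iff_forall_notMem.1 hemp s)⟩
    · obtain ⟨s₀, hs₀, hle⟩ := Set.exists_min_image _ (fun s : ℚ => |ξ - s|) hfin' hne
      exact ⟨|ξ - s₀|, abs_pos.2 (sub_ne_zero.2 hs₀.2.symm), fun s hs hsξ => hle s ⟨hs, hsξ⟩⟩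
  have hlim : ∀ᶠ n : ℕ in atTop, ((b : ℝ) ^ n)⁻¹ < ε := by
    have := tendsto_pow_atTop_nhds_zero_of_lt_one (r := (b : ℝ)⁻¹) (by positivity)
      (inv_lt_one_of_one_lt₀ hb1)
    simpa only [inv_pow] using this.eventually_lt_const hε
  obtain ⟨n, hn, hnε⟩ := (h.and_eventually hlim).exists
  obtain ⟨p, q, hq, hne, hlt, hlt'⟩ := exists_rat_approx hb hx n hμ hn
  have hcast : (((p : ℚ) / (q : ℚ) : ℚ) : ℝ) = (p : ℝ) / q := by push_cast; rfl
  have := hmin ((p : ℚ) / q) ⟨p, q, hq, rfl, hlt⟩ (by rw [hcast]; exact hne.symm)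
  rw [hcast] at this
  linarith

end Expansion

/-! ### The two bounds. -/

theorem theorem2 (b : ℕ) (hb : 2 ≤ b) (x : ℕ → Fin b) (hx : ¬ UltimatelyPeriodic x) (ρ : ℝ)
    (hρ : Filter.limsup (fun n : ℕ => (((complexity n x : ℝ) / (n : ℝ) : ℝ) : EReal))
      Filter.atTop = (ρ : EReal))
    (hρ_lt : ρ < 4 / 3) :
    Filter.liminf (fun n : ℕ => (((repetition n x : ℝ) / (n : ℝ) : ℝ) : EReal)) Filter.atTop ≤
        ((1 - (4 - 3 * ρ) / (2 * (1 + 2 * ρ) * (2 - ρ)) : ℝ) : EReal) ∧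
      ((2 + (4 - 3 * ρ) / (ρ * (9 - 4 * ρ)) : ℝ) : EReal) ≤
        irrationalityExponent (∑' j : ℕ, ((x j : ℕ) : ℝ) / (b : ℝ) ^ (j + 1)) := by
  have hupper : ∀ r : ℝ, ρ < r → ∀ᶠ n : ℕ in atTop, (complexity n x : ℝ) < r * n := by
    intro r hr
    have := eventually_lt_of_limsup_lt (hρ ▸ (EReal.coe_lt_coe_iff.2 hr))
    filter_upwards [this, eventually_gt_atTop 0] with n hn hn0
    have hn0' : (0 : ℝ) < n := Nat.cast_pos.2 hn0
    exact (div_lt_iff₀ hn0').1 (EReal.coe_lt_coe_iff.1 hn)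
  have hρ1 : 1 ≤ ρ := by
    refine le_of_forall_gt_imp_ge_of_dense fun r hr => ?_
    obtain ⟨n, hn, hn0⟩ := ((hupper r hr).and (eventually_gt_atTop 0)).exists
    have hn0' : (0 : ℝ) < n := Nat.cast_pos.2 hn0
    have h1 : ((n + 1 : ℕ) : ℝ) ≤ complexity n x := Nat.cast_le.2 (lt_complexity hx n)
    push_cast at h1
    by_contra hcon
    nlinarith
  have hd : 0 < 2 * (1 + 2 * ρ) * (2 - ρ) := by
    apply mul_pos <;> linarith
  have first : Filter.liminf (fun n : ℕ => (((repetition n x : ℝ) / (n : ℝ) : ℝ) : EReal))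
      Filter.atTop ≤ ((1 - (4 - 3 * ρ) / (2 * (1 + 2 * ρ) * (2 - ρ)) : ℝ) : EReal) := by
    by_contra! hcon
    have hlower := eventually_lt_of_lt_liminf hcon
    set σ := ρ + (4 / 3 - ρ) / 100 with hσ
    have hlam : 8 / 25 + σ / 2 ≤ 1 - (4 - 3 * ρ) / (2 * (1 + 2 * ρ) * (2 - ρ)) := by
      rw [le_sub_comm, div_le_iff₀ hd, hσ]
      -- What remains is a cubic in `ρ`, positive on `[1, 4/3]` with its minimum there close to `59
      -- / 50`.
      nlinarith [mul_nonneg (sub_nonneg.2 hρ1) (sq_nonneg (ρ - 59 / 50)), sq_nonneg (ρ - 59 / 50),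
        mul_nonneg (sub_nonneg.2 hρ1) (sub_nonneg.2 hρ_lt.le)]
    have hev : ∀ᶠ n : ℕ in atTop, (complexity n x : ℝ) + 2 ≤ σ * n := by
      have h1 := hupper (ρ + (4 / 3 - ρ) / 200) (by linarith)
      have h2 : ∀ᶠ n : ℕ in atTop, 2 / ((4 / 3 - ρ) / 200) ≤ (n : ℝ) :=
        tendsto_natCast_atTop_atTop.eventually_ge_atTop _
      filter_upwards [h1, h2] with n hn hn'
      rw [div_le_iff₀ (by linarith)] at hn'
      rw [hσ]
      nlinarith
    have hrep : ∀ᶠ n : ℕ in atTop, (8 / 25 + σ / 2) * (n : ℝ) ≤ repetition n x := by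
      filter_upwards [hlower, eventually_gt_atTop 0] with n hn hn0
      have hn0' : (0 : ℝ) < n := Nat.cast_pos.2 hn0
      have := (lt_div_iff₀ hn0').1 (EReal.coe_lt_coe_iff.1 hn)
      exact (mul_le_mul_of_nonneg_right hlam hn0'.le).trans this.le
    obtain ⟨N, hN⟩ := eventually_atTop.1 (hev.and hrep)
    have hfreq : ∃ᶠ n in atTop, complexity n x + 2 * N < 2 * n := by
      have h2 : ∀ᶠ n : ℕ in atTop, (3 * N : ℝ) ≤ (n : ℝ) :=
        tendsto_natCast_atTop_atTop.eventually_ge_atTop _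
      refine (hev.and h2).frequently.mono fun n hn => ?_
      have h3 : σ * n ≤ 4 / 3 * n :=
        mul_le_mul_of_nonneg_right (by rw [hσ]; linarith) (Nat.cast_nonneg _)
      have : (complexity n x : ℝ) + 2 * N < 2 * n := by linarith [hn.1, hn.2]
      exact_mod_cast this
    obtain ⟨n, len, q, d, t, v, s, hn, T⟩ := exists_withTail_of_complexity_lt hx N hfreq
    exact T.false_of_growth hx (by rw [hσ]; linarith) (by rw [hσ]; linarith)
      (fun m hm => (hN m (hn.trans hm)).1) (fun m hm => (hN m (hn.trans hm)).2)
  refine ⟨first, ?_⟩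
  have hξ : (∑' j : ℕ, ((x j : ℕ) : ℝ) / (b : ℝ) ^ (j + 1)) = expansionTail x 0 := by
    simp [expansionTail]
  rw [hξ]
  have hd' : 0 < ρ * (9 - 4 * ρ) := by
    apply mul_pos <;> linarith
  -- The claimed exponent is `1 + 1 / L`, where `L` is the bound for the liminf.
  have hprod : (1 - (4 - 3 * ρ) / (2 * (1 + 2 * ρ) * (2 - ρ))) *
      (1 + (4 - 3 * ρ) / (ρ * (9 - 4 * ρ))) = 1 := by
    rw [one_sub_div hd.ne', one_add_div hd'.ne', div_mul_div_comm,
      div_eq_one_iff_eq (mul_pos hd hd').ne']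
    ring
  set L := 1 - (4 - 3 * ρ) / (2 * (1 + 2 * ρ) * (2 - ρ)) with hL
  have hpos : 0 ≤ (4 - 3 * ρ) / (ρ * (9 - 4 * ρ)) := div_nonneg (by linarith) hd'.le
  have hLpos : 0 < L := pos_of_mul_pos_left (hprod ▸ one_pos) (by linarith)
  refine EReal.ge_of_forall_gt_iff_ge.1 fun μ hμ => ?_
  have hμ' := EReal.coe_lt_coe_iff.1 hμ
  -- Raising `μ` to at least `3 / 2` keeps `ν - 1` positive.
  refine (EReal.coe_le_coe_iff.2 (le_max_left μ (3 / 2))).trans ?_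
  have hν : max μ (3 / 2) < 2 + (4 - 3 * ρ) / (ρ * (9 - 4 * ρ)) := max_lt hμ' (by linarith)
  have hν' : 3 / 2 ≤ max μ (3 / 2) := le_max_right _ _
  set ν := max μ (3 / 2)
  have hLν : L < 1 / (ν - 1) := by
    rw [lt_div_iff₀ (by linarith), ← hprod]
    exact mul_lt_mul_of_pos_left (by linarith) hLpos
  refine le_irrationalityExponent hb hx (by linarith) ?_
  have hfreq := frequently_lt_of_liminf_lt (by isBoundedDefault)
    (first.trans_lt (EReal.coe_lt_coe_iff.2 hLν))
  refine (hfreq.and_eventually (eventually_gt_atTop 0)).mono fun n hn => ?_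
  have hn0 : (0 : ℝ) < n := Nat.cast_pos.2 hn.2
  have h1 := EReal.coe_lt_coe_iff.1 hn.1
  rw [div_lt_div_iff₀ hn0 (by linarith)] at h1
  linarith
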